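/- Consider a finite two-player zero-sum stochastic game with state set $K=\{1,\dots,n\}$, $n\ge 1$, finite non-empty action sets $I^\ell$ (Player 1) and $J^\ell$ (Player 2) at each state $\ell\in K$, payoff function $g$ and transition function $q$ (so $q(\cdot\,|\,\ell,i,j)$ is a probability on $K$). Assume that for some integer $N\ge 1$, $$g(\ell,i,j),\ q(\ell'\,|\,\ell,i,j)\in\left\{0,\tfrac1N,\tfrac2N,\dots,1\right\}\qquad\text{for all }\ell,\ell'\in K,\ (i,j)\in I^\ell\times J^\ell .$$ At each stage $m\ge 1$ the players, knowing all past states and actions and the current state $k_m$, independently draw actions $i_m\in I^{k_m}$ and $j_m\in J^{k_m}$, and the next state is drawn from $q(\cdot\,|\,k_m,i_m,j_m)$. For strategies $\sigma,\tau$ of Players 1 and 2 (possibly randomised and history-dependent), an initial state $k$ and a discount factor $\lambda\in(0,1]$, let $$\gamma^k_\lambda(\sigma,\tau)=\mathbb E^k_{\sigma,\tau}\Big[\sum_{m\ge1}\lambda(1-\lambda)^{m-1}g(k_m,i_m,j_m)\Big].$$ Let $|I|=\prod_{\ell=1}^n|I^\ell|$ be the number of pure stationary strategies of Player 1, and let $\mathsf{bit}(N)=\lceil\log_2(N+1)\rceil$.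 Fix an initial state $k\in K$. For every $\lambda\in(0,1]$ the value $$v^k_\lambda=\sup_\sigma\inf_\tau\gamma^k_\lambda(\sigma,\tau)=\inf_\tau\sup_\sigma\gamma^k_\lambda(\sigma,\tau)$$ exists, the limit $\lim_{\lambda\to0^+}v^k_\lambda$ exists, and for every integer $r\ge 0$, setting $\lambda_r:=2^{-10|I|^2n^2\mathsf{bit}(N)\,r}$, $$\Big|v^k_\lambda-\lim_{\lambda'\to0^+}v^k_{\lambda'}\Big|\le 2^{-r}\qquad\text{for all }\lambda\in(0,\lambda_r].$$ -/

import Mathlib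

open MeasureTheory ProbabilityTheory Filter Topology
open scoped ENNReal

noncomputable section

/-- The triples `(state, action of Player 1, action of Player 2)`, i.e. the set
`Z = {(k, i, j) | k ∈ K, (i, j) ∈ I^k × J^k}`, where the state set is `Fin n`. -/
structure Triple {n : ℕ} (I : Fin n → Type*) (J : Fin n → Type*) where
  /-- the current state -/
  state : Fin n
  /-- the action of Player 1 -/
  act₁ : I state
  /-- the action of Player 2 -/
  act₂ : J state

instance Triple.instMeasurableSpace {n : ℕ} (I : Fin n → Type*) (J : Fin n → Type*) :
    MeasurableSpace (Triple I J) := ⊤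

instance Triple.instDiscreteMeasurableSpace {n : ℕ} (I : Fin n → Type*) (J : Fin n → Type*) :
    DiscreteMeasurableSpace (Triple I J) := ⟨fun _ => trivial⟩

instance Triple.instFinite {n : ℕ} (I : Fin n → Type*) (J : Fin n → Type*)
    [∀ ℓ, Finite (I ℓ)] [∀ ℓ, Finite (J ℓ)] : Finite (Triple I J) :=
  Finite.of_injective (β := Σ ℓ : Fin n, I ℓ × J ℓ) (fun z => ⟨z.state, z.act₁, z.act₂⟩) (by
    rintro ⟨a, b, c⟩ ⟨a', b', c'⟩ h
    cases h
    rfl)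

/-- A two-player zero-sum stochastic game with state set `Fin n` and action sets `I ℓ`, `J ℓ` at
state `ℓ`: a payoff function `g` and a transition function `q` with values in `Δ(K)`. -/
structure StochasticGame {n : ℕ} (I : Fin n → Type*) (J : Fin n → Type*) where
  /-- the payoff function (Player 1 maximises) -/
  g : Triple I J → ℝ
  /-- the transition function -/
  q : Triple I J → stdSimplex ℝ (Fin n)

/-- A point of `Δ(E)`, `E` finite, as a probability mass function. -/
def simplexPMF {E : Type*} [Fintype E] (p : stdSimplex ℝ E) : PMF E :=
  PMF.ofFintype (fun a => ENNReal.ofReal (p.1 a)) (by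
    rw [← ENNReal.ofReal_sum_of_nonneg (fun a _ => p.2.1 a), p.2.2, ENNReal.ofReal_one])

/-- Behavioural strategies of the player whose action sets are `A`. After the `m` past
observations `h : Fin m → Triple I J` and in the current state `ℓ`, an action is drawn from
`σ m h ℓ`. Stages are numbered from `0`. -/
abbrev Strategy {n : ℕ} (I : Fin n → Type*) (J : Fin n → Type*) (A : Fin n → Type*)
    [∀ ℓ, Fintype (A ℓ)] : Type _ :=
  (m : ℕ) → (Fin m → Triple I J) → (ℓ : Fin n) → stdSimplex ℝ (A ℓ)

namespace StochasticGame

variable {n : ℕ} {I : Fin n → Type*} {J : Fin n → Type*}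

/-- The law of the triple of stage `m`, given the past `h` and the current state `ℓ`:
the two actions are drawn independently. -/
def stageLaw [∀ ℓ, Fintype (I ℓ)] [∀ ℓ, Fintype (J ℓ)]
    (σ : Strategy I J I) (τ : Strategy I J J) (m : ℕ)
    (h : Fin m → Triple I J) (ℓ : Fin n) : PMF (Triple I J) :=
  (simplexPMF (σ m h ℓ)).bind fun i => (simplexPMF (τ m h ℓ)).bind fun j => PMF.pure ⟨ℓ, i, j⟩

/-- The law of the triple of stage `m + 1`, given the triples `h 0, …, h m` of the stages
`0, …, m`: the new state is drawn from `q (h m)`, then the actions are drawn. -/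
def nextLaw [∀ ℓ, Fintype (I ℓ)] [∀ ℓ, Fintype (J ℓ)] (G : StochasticGame I J)
    (σ : Strategy I J I) (τ : Strategy I J J) (m : ℕ)
    (h : Fin (m + 1) → Triple I J) : PMF (Triple I J) :=
  (simplexPMF (G.q (h (Fin.last m)))).bind fun ℓ => stageLaw σ τ (m + 1) h ℓ

/-- `nextLaw` as a Markov kernel. -/
def stepKernel [∀ ℓ, Fintype (I ℓ)] [∀ ℓ, Fintype (J ℓ)] (G : StochasticGame I J)
    (σ : Strategy I J I) (τ : Strategy I J J) (m : ℕ) :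
    Kernel (Finset.Iic m → Triple I J) (Triple I J) :=
  Kernel.ofFunOfCountable fun h =>
    (G.nextLaw σ τ m fun t => h ⟨t, Finset.mem_Iic.2 (Nat.lt_succ_iff.1 t.2)⟩).toMeasure

instance instIsMarkovKernelStepKernel [∀ ℓ, Fintype (I ℓ)] [∀ ℓ, Fintype (J ℓ)]
    (G : StochasticGame I J) (σ : Strategy I J I) (τ : Strategy I J J) (m : ℕ) :
    IsMarkovKernel (G.stepKernel σ τ m) :=
  ⟨fun _ => PMF.toMeasure.isProbabilityMeasure _⟩

/-- The probability `ℙ^k_{σ,τ}` on the set of plays `ℕ → Triple I J` (with the product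
σ-algebra) induced by the initial state `k` and the strategies `σ` and `τ`. -/
def playLaw [∀ ℓ, Fintype (I ℓ)] [∀ ℓ, Fintype (J ℓ)] (G : StochasticGame I J)
    (σ : Strategy I J I) (τ : Strategy I J J) (k : Fin n) : Measure (ℕ → Triple I J) :=
  Kernel.trajMeasure (X := fun _ => Triple I J) (stageLaw σ τ 0 Fin.elim0 k).toMeasure
    (G.stepKernel σ τ)

/-- The expected discounted payoff `γ^k_lam(σ, τ)`. With stages numbered from `0`, the stage `m`
has weight `lam * (1 - lam) ^ m`. -/
def payoff [∀ ℓ, Fintype (I ℓ)] [∀ ℓ, Fintype (J ℓ)] (G : StochasticGame I J)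
    (lam : ℝ) (k : Fin n) (σ : Strategy I J I) (τ : Strategy I J J) : ℝ :=
  ∫ ω, ∑' m : ℕ, lam * (1 - lam) ^ m * G.g (ω m) ∂(G.playLaw σ τ k)

/-- `sup_σ inf_τ γ^k_lam(σ, τ)`. -/
def lowerValue [∀ ℓ, Fintype (I ℓ)] [∀ ℓ, Fintype (J ℓ)] (G : StochasticGame I J)
    (lam : ℝ) (k : Fin n) : ℝ :=
  ⨆ σ : Strategy I J I, ⨅ τ : Strategy I J J, G.payoff lam k σ τ

/-- `inf_τ sup_σ γ^k_lam(σ, τ)`. -/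
def upperValue [∀ ℓ, Fintype (I ℓ)] [∀ ℓ, Fintype (J ℓ)] (G : StochasticGame I J)
    (lam : ℝ) (k : Fin n) : ℝ :=
  ⨅ τ : Strategy I J J, ⨆ σ : Strategy I J I, G.payoff lam k σ τ

/-- `v` is the value of the game with discount factor `lam` and initial state `k`. -/
def IsValue [∀ ℓ, Fintype (I ℓ)] [∀ ℓ, Fintype (J ℓ)] (G : StochasticGame I J)
    (lam : ℝ) (k : Fin n) (v : ℝ) : Prop :=
  v = G.lowerValue lam k ∧ v = G.upperValue lam k

/-- The hypothesis `(H_N)`: all payoffs and all transition probabilities belong to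
`{0, 1/N, 2/N, …, 1}`. -/
def RationalData (G : StochasticGame I J) (N : ℕ) : Prop :=
  (∀ z, ∃ m : ℕ, m ≤ N ∧ G.g z = (m : ℝ) / N) ∧
    ∀ z ℓ, ∃ m : ℕ, m ≤ N ∧ (G.q z).1 ℓ = (m : ℝ) / N

end StochasticGame

/-- The bit-size `⌈log₂ (p + 1)⌉` of a natural number. -/
def bitSize (p : ℕ) : ℕ := ⌈Real.logb 2 ((p : ℝ) + 1)⌉₊

end

/-!
# Convergence rate of the discounted values of a zero-sum stochastic game
-/

/-! ### Expectations under the law of a play -/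

section PMFIntegral

/-! Values exist by Shapley's argument: the Shapley operator is a contraction, and a fixed point
with its optimal mixed actions is a saddle point in stationary strategies, even against
history-dependent replies (`exists_shapleySolution`, `ShapleySolution.isValue`). The value is also
continuous in `λ` (`continuousOn_lowerValue`).

For the rate, the game is reduced to a matrix game over pure stationary strategies. By Cramer's rule
a pure stationary pair has payoff `numDet / denDet`, and `v` is the parameter at which the matrix
game with entries `numDet - v * denDet` has value zero. A limiting form of the Shapley–Snow argument
(`exists_singular_kernel`) then gives a square kernel whose determinant vanishes at `v` but not
identically in the parameter. Clearing denominators turns these determinants into finitely many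
integer polynomials whose coefficient sums are bounded explicitly (`l1_entryPoly_le`,
`height_lt_two_pow`).

No root separation is needed. If two small discount factors had values more than `2⁻ʳ` apart, some
dyadic `a / 2ʳ` would lie strictly between these values. By continuity the value `(a + w) / 2ʳ`
would be attained at an intermediate `λ`, for every sufficiently small `w > 0`. Some nonzero integer
polynomial would then vanish at `(w, λ)` with `w` tiny compared with a power of `λ`, and `λ` below
the inverse of the coefficient sum. This is impossible, because the lexicographically lowest
monomial dominates (`aeval_ne_zero_of_small`). Hence `abs_lowerValue_sub_le`, a Cauchy modulus that
yields both the limit and the rate. -/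

theorem integral_pmf_bind {α β : Type*} [Fintype α]
    [Finite β] [MeasurableSpace β] [MeasurableSingletonClass β] (p : PMF α) (q : α → PMF β) (f : β → ℝ) :
    ∫ b, f b ∂(p.bind q).toMeasure = ∑ a, (p a).toReal * ∫ b, f b ∂(q a).toMeasure := by
  have := Fintype.ofFinite β
  simp_rw [PMF.integral_eq_sum, PMF.bind_apply, tsum_fintype, smul_eq_mul, Finset.mul_sum]
  rw [Finset.sum_comm]
  refine Finset.sum_congr rfl fun b _ => ?_
  rw [ENNReal.toReal_sum fun a _ => ENNReal.mul_ne_top (p.apply_ne_top a) ((q a).apply_ne_top b),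
    Finset.sum_mul]
  refine Finset.sum_congr rfl fun a _ => ?_
  rw [ENNReal.toReal_mul, mul_assoc]

theorem integral_pmf_pure {β : Type*} [Finite β] [MeasurableSpace β] [MeasurableSingletonClass β] (b : β) (f : β → ℝ) :
    ∫ x, f x ∂(PMF.pure b).toMeasure = f b := by
  rw [PMF.toMeasure_pure, integral_dirac]

theorem simplexPMF_apply_toReal {E : Type*} [Fintype E] (p : stdSimplex ℝ E) (a : E) :
    (simplexPMF p a).toReal = p.1 a := by
  simp [simplexPMF, ENNReal.toReal_ofReal (p.2.1 a)]

end PMFIntegral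

namespace StochasticGame

variable {n : ℕ} {I : Fin n → Type*} {J : Fin n → Type*} [∀ ℓ, Fintype (I ℓ)] [∀ ℓ, Fintype (J ℓ)]

theorem integral_stageLaw (σ : Strategy I J I) (τ : Strategy I J J) (m : ℕ)
    (h : Fin m → Triple I J) (ℓ : Fin n) (f : Triple I J → ℝ) :
    ∫ z, f z ∂(stageLaw σ τ m h ℓ).toMeasure =
      ∑ i, ∑ j, (σ m h ℓ).1 i * (τ m h ℓ).1 j * f ⟨ℓ, i, j⟩ := by
  unfold stageLaw
  simp_rw [integral_pmf_bind, integral_pmf_pure, simplexPMF_apply_toReal, Finset.mul_sum, mul_assoc]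

theorem integral_nextLaw (G : StochasticGame I J) (σ : Strategy I J I) (τ : Strategy I J J) (m : ℕ)
    (h : Fin (m + 1) → Triple I J) (f : Triple I J → ℝ) :
    ∫ z, f z ∂(G.nextLaw σ τ m h).toMeasure =
      ∑ ℓ, (G.q (h (Fin.last m))).1 ℓ * ∫ z, f z ∂(stageLaw σ τ (m + 1) h ℓ).toMeasure := by
  unfold nextLaw
  simp_rw [integral_pmf_bind, simplexPMF_apply_toReal]

instance (G : StochasticGame I J) (σ : Strategy I J I) (τ : Strategy I J J) (k : Fin n) :
    IsProbabilityMeasure (G.playLaw σ τ k) := by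
  unfold playLaw
  infer_instance

theorem integral_playLaw_zero (G : StochasticGame I J) (σ : Strategy I J I) (τ : Strategy I J J)
    (k : Fin n) (f : Triple I J → ℝ) :
    ∫ ω, f (ω 0) ∂(G.playLaw σ τ k) = ∫ z, f z ∂(stageLaw σ τ 0 Fin.elim0 k).toMeasure := by
  have hf : Measurable f := measurable_from_top
  set μ₀ := (stageLaw σ τ 0 Fin.elim0 k).toMeasure
  have h : (G.playLaw σ τ k).map (Preorder.frestrictLe 0) =
      μ₀.map (MeasurableEquiv.piUnique (fun _ : Finset.Iic 0 => Triple I J)).symm := by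
    unfold playLaw Kernel.trajMeasure
    rw [Measure.map_comp _ _ (by fun_prop), Kernel.traj_map_frestrictLe,
      Kernel.partialTraj_self]
    exact Measure.id_comp
  have h2 : (G.playLaw σ τ k).map (fun ω => ω 0) = μ₀ := by
    have e : (fun ω : ℕ → Triple I J => ω 0) =
      (fun x : Finset.Iic 0 → Triple I J => x ⟨0, by simp⟩) ∘ Preorder.frestrictLe 0 := rfl
    rw [e, ← Measure.map_map (measurable_pi_apply _) (by fun_prop)]
    erw [h]
    rw [Measure.map_map (measurable_pi_apply _) (by fun_prop)]
    convert Measure.map_id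
    funext z
    simp [MeasurableEquiv.piUnique, Equiv.piUnique]
  rw [← h2, integral_map (measurable_pi_apply 0).aemeasurable hf.aestronglyMeasurable]

/-- The joint law of the history up to stage `m` and of the triple of stage `m + 1` disintegrates
through `stepKernel`; this is the only fact about the trajectory measure needed beyond its initial
law. -/
theorem integral_playLaw_succ (G : StochasticGame I J) (σ : Strategy I J I) (τ : Strategy I J J)
    (k : Fin n) (m : ℕ) (f : Triple I J → ℝ) :
    ∫ ω, f (ω (m + 1)) ∂(G.playLaw σ τ k) =
      ∫ ω, (∫ z, f z ∂(G.nextLaw σ τ m fun t => ω t).toMeasure) ∂(G.playLaw σ τ k) := by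
  have hf : Measurable f := measurable_from_top
  have key := Kernel.map_frestrictLe_trajMeasure_compProd_eq_map_trajMeasure
    (X := fun _ => Triple I J) (μ₀ := (stageLaw σ τ 0 Fin.elim0 k).toMeasure)
    (κ := G.stepKernel σ τ) (a := m)
  have hb : ∃ C, ∀ z, ‖f z‖ ≤ C := by
    obtain ⟨C, hC⟩ := (Set.finite_range fun z => ‖f z‖).bddAbove
    exact ⟨C, fun z => hC ⟨z, rfl⟩⟩
  obtain ⟨C, hC⟩ := hb
  change (G.playLaw σ τ k).map _ ⊗ₘ _ = (G.playLaw σ τ k).map _ at key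
  have e1 : ∫ ω, f (ω (m + 1)) ∂(G.playLaw σ τ k) =
      ∫ p, f p.2 ∂((G.playLaw σ τ k).map
        (fun x => (Preorder.frestrictLe m x, x (m + 1)))) := by
    rw [integral_map (by fun_prop) (by fun_prop)]
  have : IsProbabilityMeasure ((G.playLaw σ τ k).map (Preorder.frestrictLe (π := fun _ => Triple I J) m)) :=
    Measure.isProbabilityMeasure_map (by fun_prop)
  rw [e1, ← key, Measure.integral_compProd, integral_map (by fun_prop)]
  · rfl
  · exact (measurable_of_countable _).aestronglyMeasurable
  · exact Integrable.of_bound (by fun_prop) C (ae_of_all _ fun p => hC _)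

end StochasticGame

/-! ### Discounted payoffs, Shapley defects and saddle points -/

namespace StochasticGame

variable {n : ℕ} {I : Fin n → Type*} {J : Fin n → Type*}

/-- The defect of `f` in the Shapley equation, at a triple `z`. -/
noncomputable def defect (G : StochasticGame I J) (lam : ℝ) (f : Fin n → ℝ) (z : Triple I J) : ℝ :=
  lam * G.g z + (1 - lam) * ∑ ℓ, (G.q z).1 ℓ * f ℓ - f z.state

theorem defect_const (G : StochasticGame I J) (lam c : ℝ) (z : Triple I J) :
    G.defect lam (fun _ => c) z = lam * (G.g z - c) := by
  have h : ∑ ℓ, (G.q z).1 ℓ = 1 := (G.q z).2.2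
  unfold defect
  rw [← Finset.sum_mul, h]
  ring

variable [∀ ℓ, Fintype (I ℓ)] [∀ ℓ, Fintype (J ℓ)]

theorem integrable_coord (G : StochasticGame I J) (σ : Strategy I J I) (τ : Strategy I J J)
    (k : Fin n) (m : ℕ) (f : Triple I J → ℝ) :
    Integrable (fun ω : ℕ → Triple I J => f (ω m)) (G.playLaw σ τ k) := by
  have hf : Measurable f := measurable_from_top
  obtain ⟨C, hC⟩ := (Set.finite_range fun z => ‖f z‖).bddAbove
  exact Integrable.of_bound (hf.comp (measurable_pi_apply m)).aestronglyMeasurable C (ae_of_all _ fun ω => hC ⟨ω m, rfl⟩)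

/-- Conditionally on the past and the current state, the expectation is the bilinear form of the
hypothesis, so a sign valid after every history survives averaging. -/
theorem integral_coord_nonneg (G : StochasticGame I J) (σ : Strategy I J I) (τ : Strategy I J J)
    (k : Fin n) (f : Triple I J → ℝ)
    (hf : ∀ m h ℓ, 0 ≤ ∑ i, ∑ j, (σ m h ℓ).1 i * (τ m h ℓ).1 j * f ⟨ℓ, i, j⟩) (m : ℕ) :
    0 ≤ ∫ ω, f (ω m) ∂(G.playLaw σ τ k) := by
  cases m with
  | zero =>
    rw [integral_playLaw_zero, integral_stageLaw]
    exact hf _ _ _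
  | succ m =>
    rw [integral_playLaw_succ]
    refine integral_nonneg fun ω => ?_
    simp only [integral_nextLaw, integral_stageLaw]
    exact Finset.sum_nonneg fun ℓ _ => mul_nonneg ((G.q _).2.1 ℓ) (hf _ _ _)

theorem sum_mul_sum_stdSimplex {A B : Type*} [Fintype A] [Fintype B] (p : stdSimplex ℝ A)
    (q : stdSimplex ℝ B) (c : ℝ) : ∑ i, ∑ j, p.1 i * q.1 j * c = c := by
  have hp := p.2.2
  have hq := q.2.2
  simp_rw [← Finset.sum_mul, ← Finset.mul_sum]
  rw [hq, ← Finset.sum_mul, hp, one_mul, one_mul]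

theorem integral_state_zero (G : StochasticGame I J) (σ : Strategy I J I) (τ : Strategy I J J)
    (k : Fin n) (f : Fin n → ℝ) :
    ∫ ω, f (ω 0).state ∂(G.playLaw σ τ k) = f k := by
  rw [integral_playLaw_zero G σ τ k (fun z => f z.state), integral_stageLaw]
  exact sum_mul_sum_stdSimplex (σ 0 Fin.elim0 k) (τ 0 Fin.elim0 k) (f k)

theorem integral_state_succ (G : StochasticGame I J) (σ : Strategy I J I) (τ : Strategy I J J)
    (k : Fin n) (m : ℕ) (f : Fin n → ℝ) :
    ∫ ω, f (ω (m + 1)).state ∂(G.playLaw σ τ k) =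
      ∫ ω, ∑ ℓ, (G.q (ω m)).1 ℓ * f ℓ ∂(G.playLaw σ τ k) := by
  rw [integral_playLaw_succ G σ τ k m (fun z => f z.state)]
  refine integral_congr_ae (ae_of_all _ fun ω => ?_)
  simp only [integral_nextLaw, integral_stageLaw, sum_mul_sum_stdSimplex]
  rfl

theorem norm_integral_coord_le (G : StochasticGame I J) (σ : Strategy I J I) (τ : Strategy I J J)
    (k : Fin n) (m : ℕ) (f : Triple I J → ℝ) {C : ℝ} (hC : ∀ z, ‖f z‖ ≤ C) :
    ∫ ω, ‖f (ω m)‖ ∂(G.playLaw σ τ k) ≤ C := by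
  calc _ ≤ ∫ _, C ∂(G.playLaw σ τ k) :=
        integral_mono (G.integrable_coord σ τ k m fun z => ‖f z‖) (integrable_const C)
          fun ω => hC (ω m)
    _ = C := by simp

theorem hasSum_payoff (G : StochasticGame I J) {lam : ℝ} (h0 : 0 < lam) (h1 : lam ≤ 1)
    (σ : Strategy I J I) (τ : Strategy I J J) (k : Fin n) :
    HasSum (fun m : ℕ => lam * (1 - lam) ^ m * ∫ ω, G.g (ω m) ∂(G.playLaw σ τ k))
      (G.payoff lam k σ τ) := by
  obtain ⟨C, hC⟩ := (Set.finite_range fun z => ‖G.g z‖).bddAbove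
  have hC' : ∀ z, ‖G.g z‖ ≤ C := fun z => hC ⟨z, rfl⟩
  have hr : 0 ≤ 1 - lam := by linarith
  have hs : Summable fun m : ℕ => (1 - lam) ^ m := summable_geometric_of_lt_one hr (by linarith)
  have := hasSum_integral_of_summable_integral_norm (μ := G.playLaw σ τ k)
    (F := fun (m : ℕ) ω => lam * (1 - lam) ^ m * G.g (ω m))
    (fun m => (G.integrable_coord σ τ k m G.g).const_mul _) (by
      refine Summable.of_nonneg_of_le (fun m => integral_nonneg fun _ => norm_nonneg _)
        (fun m => ?_) ((hs.mul_left lam).mul_right C)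
      simp_rw [norm_mul]
      rw [integral_const_mul, ← norm_mul, Real.norm_of_nonneg (by positivity)]
      exact mul_le_mul_of_nonneg_left (norm_integral_coord_le G σ τ k m G.g hC') (by positivity))
  simp only [integral_const_mul] at this
  exact this

/-- With `u m` the expectation of `f` at the state of stage `m`, the expected defect is `lam * E[g]
+ (1 - lam) * u (m + 1) - u m`. Weighted by `(1 - lam) ^ m`, the `u` terms telescope to `-u 0 = -f
k`. -/
theorem hasSum_defect (G : StochasticGame I J) {lam : ℝ} (h0 : 0 < lam) (h1 : lam ≤ 1)
    (σ : Strategy I J I) (τ : Strategy I J J) (k : Fin n) (f : Fin n → ℝ) :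
    HasSum (fun m : ℕ => (1 - lam) ^ m * ∫ ω, G.defect lam f (ω m) ∂(G.playLaw σ τ k))
      (G.payoff lam k σ τ - f k) := by
  obtain ⟨C, hC⟩ := (Set.finite_range fun z : Triple I J => ‖f z.state‖).bddAbove
  have hC' : ∀ z : Triple I J, ‖f z.state‖ ≤ C := fun z => hC ⟨z, rfl⟩
  have hr : 0 ≤ 1 - lam := by linarith
  have hs : Summable fun m : ℕ => (1 - lam) ^ m := summable_geometric_of_lt_one hr (by linarith)
  set u : ℕ → ℝ := fun m => ∫ ω, f (ω m).state ∂(G.playLaw σ τ k) with hu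
  have hsu : Summable fun m => (1 - lam) ^ m * u m := by
    refine Summable.of_norm_bounded (hs.mul_right C) fun m => ?_
    rw [norm_mul, Real.norm_of_nonneg (pow_nonneg hr m)]
    exact mul_le_mul_of_nonneg_left ((norm_integral_le_integral_norm _).trans
      (norm_integral_coord_le G σ τ k m (fun z => f z.state) hC')) (pow_nonneg hr m)
  have h2 := (hasSum_nat_add_iff' 1).2 hsu.hasSum
  have h3 := ((G.hasSum_payoff h0 h1 σ τ k).add h2).sub hsu.hasSum
  have hterm : ∀ m, (1 - lam) ^ m * ∫ ω, G.defect lam f (ω m) ∂(G.playLaw σ τ k) =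
      lam * (1 - lam) ^ m * (∫ ω, G.g (ω m) ∂(G.playLaw σ τ k)) +
        (1 - lam) ^ (m + 1) * u (m + 1) - (1 - lam) ^ m * u m := by
    intro m
    have e : ∫ ω, G.defect lam f (ω m) ∂(G.playLaw σ τ k) =
        lam * (∫ ω, G.g (ω m) ∂(G.playLaw σ τ k)) + (1 - lam) * u (m + 1) - u m := by
      simp only [hu, integral_state_succ]
      rw [← integral_const_mul, ← integral_const_mul, ← integral_add, ← integral_sub]
      · rfl
      · exact G.integrable_coord σ τ k m
          (fun z => lam * G.g z + (1 - lam) * ∑ ℓ, (G.q z).1 ℓ * f ℓ)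
      · exact G.integrable_coord σ τ k m fun z => f z.state
      · exact G.integrable_coord σ τ k m fun z => lam * G.g z
      · exact G.integrable_coord σ τ k m fun z => (1 - lam) * ∑ ℓ, (G.q z).1 ℓ * f ℓ
    rw [e]
    ring
  have h0' : u 0 = f k := G.integral_state_zero σ τ k f
  have hval : G.payoff lam k σ τ + (∑' b, (1 - lam) ^ b * u b -
      ∑ i ∈ Finset.range 1, (1 - lam) ^ i * u i) - ∑' b, (1 - lam) ^ b * u b =
      G.payoff lam k σ τ - f k := by
    rw [Finset.sum_range_one, pow_zero, h0']
    ring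
  rw [← hval, funext hterm]
  exact h3

/-- Verification principle for arbitrary history-dependent strategies: all terms of `hasSum_defect`
are nonnegative. -/
theorem le_payoff (G : StochasticGame I J) {lam : ℝ} (h0 : 0 < lam) (h1 : lam ≤ 1)
    (σ : Strategy I J I) (τ : Strategy I J J) (k : Fin n) (f : Fin n → ℝ)
    (hf : ∀ m h ℓ, 0 ≤ ∑ i, ∑ j, (σ m h ℓ).1 i * (τ m h ℓ).1 j * G.defect lam f ⟨ℓ, i, j⟩) :
    f k ≤ G.payoff lam k σ τ := by
  have := (G.hasSum_defect h0 h1 σ τ k f).nonneg fun m =>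
    mul_nonneg (pow_nonneg (by linarith) m) (G.integral_coord_nonneg σ τ k _ hf m)
  linarith

theorem payoff_le (G : StochasticGame I J) {lam : ℝ} (h0 : 0 < lam) (h1 : lam ≤ 1)
    (σ : Strategy I J I) (τ : Strategy I J J) (k : Fin n) (f : Fin n → ℝ)
    (hf : ∀ m h ℓ, ∑ i, ∑ j, (σ m h ℓ).1 i * (τ m h ℓ).1 j * G.defect lam f ⟨ℓ, i, j⟩ ≤ 0) :
    G.payoff lam k σ τ ≤ f k := by
  have := (G.hasSum_defect h0 h1 σ τ k f).nonpos fun m =>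
    mul_nonpos_of_nonneg_of_nonpos (pow_nonneg (by linarith) m) (by
      have := G.integral_coord_nonneg σ τ k (fun z => -G.defect lam f z) (fun m h ℓ => by
        simpa only [mul_neg, Finset.sum_neg_distrib, Left.nonneg_neg_iff] using hf m h ℓ) m
      rw [integral_neg] at this
      linarith)
  linarith

theorem payoff_nonneg (G : StochasticGame I J) {lam : ℝ} (h0 : 0 < lam) (h1 : lam ≤ 1)
    (hg : ∀ z, 0 ≤ G.g z) (σ : Strategy I J I) (τ : Strategy I J J) (k : Fin n) :
    0 ≤ G.payoff lam k σ τ := by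
  refine G.le_payoff h0 h1 σ τ k (fun _ => 0) fun m h ℓ =>
    Finset.sum_nonneg fun i _ => Finset.sum_nonneg fun j _ =>
      mul_nonneg (mul_nonneg ((σ m h ℓ).2.1 i) ((τ m h ℓ).2.1 j)) ?_
  rw [defect_const]
  exact mul_nonneg h0.le (by linarith [hg ⟨ℓ, i, j⟩])

theorem payoff_le_one (G : StochasticGame I J) {lam : ℝ} (h0 : 0 < lam) (h1 : lam ≤ 1)
    (hg : ∀ z, G.g z ≤ 1) (σ : Strategy I J I) (τ : Strategy I J J) (k : Fin n) :
    G.payoff lam k σ τ ≤ 1 := by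
  refine G.payoff_le h0 h1 σ τ k (fun _ => 1) fun m h ℓ =>
    Finset.sum_nonpos fun i _ => Finset.sum_nonpos fun j _ =>
      mul_nonpos_of_nonneg_of_nonpos (mul_nonneg ((σ m h ℓ).2.1 i) ((τ m h ℓ).2.1 j)) ?_
  rw [defect_const]
  exact mul_nonpos_of_nonneg_of_nonpos h0.le (by linarith [hg ⟨ℓ, i, j⟩])

/-- `f` solves the Shapley equation, with optimal mixed actions `x ℓ` and `y ℓ`. -/
structure ShapleySolution (G : StochasticGame I J) (lam : ℝ) (f : Fin n → ℝ)
    (x : ∀ ℓ, stdSimplex ℝ (I ℓ)) (y : ∀ ℓ, stdSimplex ℝ (J ℓ)) : Prop where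
  left : ∀ ℓ j, 0 ≤ ∑ i, (x ℓ).1 i * G.defect lam f ⟨ℓ, i, j⟩
  right : ∀ ℓ i, ∑ j, (y ℓ).1 j * G.defect lam f ⟨ℓ, i, j⟩ ≤ 0

section

variable {G : StochasticGame I J} {lam : ℝ} {f : Fin n → ℝ}
  {x : ∀ ℓ, stdSimplex ℝ (I ℓ)} {y : ∀ ℓ, stdSimplex ℝ (J ℓ)}

theorem ShapleySolution.le_payoff (hf : G.ShapleySolution lam f x y) (h0 : 0 < lam) (h1 : lam ≤ 1)
    (k : Fin n) (τ : Strategy I J J) : f k ≤ G.payoff lam k (fun _ _ ℓ => x ℓ) τ :=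
  G.le_payoff h0 h1 _ _ k f fun m h ℓ => by
    rw [Finset.sum_comm]
    refine Finset.sum_nonneg fun j _ => ?_
    have := mul_nonneg ((τ m h ℓ).2.1 j) (hf.left ℓ j)
    rw [Finset.mul_sum] at this
    exact this.trans_eq (Finset.sum_congr rfl fun i _ => by ring)

theorem ShapleySolution.payoff_le (hf : G.ShapleySolution lam f x y) (h0 : 0 < lam) (h1 : lam ≤ 1)
    (k : Fin n) (σ : Strategy I J I) : G.payoff lam k σ (fun _ _ ℓ => y ℓ) ≤ f k :=
  G.payoff_le h0 h1 _ _ k f fun m h ℓ => by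
    refine Finset.sum_nonpos fun i _ => ?_
    have := mul_nonpos_of_nonneg_of_nonpos ((σ m h ℓ).2.1 i) (hf.right ℓ i)
    rw [Finset.mul_sum] at this
    exact (Finset.sum_congr rfl fun i _ => by ring).trans_le this

theorem ShapleySolution.mem_Icc (hf : G.ShapleySolution lam f x y) (h0 : 0 < lam) (h1 : lam ≤ 1)
    (hg : ∀ z, G.g z ∈ Set.Icc (0 : ℝ) 1) (k : Fin n) : f k ∈ Set.Icc (0 : ℝ) 1 :=
  ⟨(G.payoff_nonneg h0 h1 (fun z => (hg z).1) _ _ k).trans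
      (hf.payoff_le h0 h1 k fun _ _ ℓ => x ℓ),
    (hf.le_payoff h0 h1 k fun _ _ ℓ => y ℓ).trans
      (G.payoff_le_one h0 h1 (fun z => (hg z).2) _ _ k)⟩

theorem ShapleySolution.isValue (hf : G.ShapleySolution lam f x y) (h0 : 0 < lam) (h1 : lam ≤ 1)
    (hg : ∀ z, G.g z ∈ Set.Icc (0 : ℝ) 1) (k : Fin n) : G.IsValue lam k (f k) := by
  have hl := hf.le_payoff h0 h1 k
  have hr := hf.payoff_le h0 h1 k
  have : Nonempty (Strategy I J I) := ⟨fun _ _ ℓ => x ℓ⟩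
  have : Nonempty (Strategy I J J) := ⟨fun _ _ ℓ => y ℓ⟩
  have hp0 := fun σ τ => G.payoff_nonneg h0 h1 (fun z => (hg z).1) σ τ k
  have hp1 := fun σ τ => G.payoff_le_one h0 h1 (fun z => (hg z).2) σ τ k
  have hb : ∀ σ, BddBelow (Set.range fun τ => G.payoff lam k σ τ) := fun σ =>
    ⟨0, by rintro _ ⟨τ, rfl⟩; exact hp0 σ τ⟩
  have ha : ∀ τ, BddAbove (Set.range fun σ => G.payoff lam k σ τ) := fun τ =>
    ⟨1, by rintro _ ⟨σ, rfl⟩; exact hp1 σ τ⟩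
  constructor
  · refine le_antisymm ?_ (ciSup_le fun σ => (ciInf_le (hb σ) _).trans (hr σ))
    exact (le_ciInf hl).trans (le_ciSup (f := fun σ => ⨅ τ, G.payoff lam k σ τ)
      ⟨f k, by rintro _ ⟨σ, rfl⟩; exact (ciInf_le (hb σ) _).trans (hr σ)⟩ fun _ _ ℓ => x ℓ)
  · refine le_antisymm (le_ciInf fun τ => (hl τ).trans (le_ciSup (ha τ) _)) ?_
    exact (ciInf_le (f := fun τ => ⨆ σ, G.payoff lam k σ τ)
      ⟨f k, by rintro _ ⟨τ, rfl⟩; exact (hl τ).trans (le_ciSup (ha τ) _)⟩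
      fun _ _ ℓ => y ℓ).trans (ciSup_le hr)

end

end StochasticGame

/-! ### Minimax theorem and monotonicity for matrix games -/

section MatrixGame

variable {A B : Type*} [Fintype A] [Fintype B]

theorem exists_matrixGame_value [Nonempty A] [Nonempty B] (M : A → B → ℝ) :
    ∃ v : ℝ, ∃ x : stdSimplex ℝ A, ∃ y : stdSimplex ℝ B,
      (∀ j, v ≤ ∑ i, x.1 i * M i j) ∧ ∀ i, ∑ j, y.1 j * M i j ≤ v := by
  classical
  let F : (B → ℝ) →ₗ[ℝ] (A → ℝ) →ₗ[ℝ] ℝ := LinearMap.mk₂ ℝ (fun y x => ∑ j, ∑ i, y j * x i * M i j)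
    (fun y y' x => by simp_rw [← Finset.sum_add_distrib, Pi.add_apply, add_mul])
    (fun c y x => by simp_rw [Finset.smul_sum, Pi.smul_apply, smul_eq_mul, mul_assoc])
    (fun y x x' => by simp_rw [← Finset.sum_add_distrib, Pi.add_apply, mul_add, add_mul])
    (fun c y x => by
      simp_rw [Finset.smul_sum, Pi.smul_apply, smul_eq_mul]
      refine Finset.sum_congr rfl fun _ _ => Finset.sum_congr rfl fun _ _ => by ring)
  have hF : ∀ y x, F y x = ∑ j, ∑ i, y j * x i * M i j := fun _ _ => rfl
  -- The minimising variable comes first in Sion's theorem, which is why `F` takes `y` before `x`.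
  obtain ⟨y, hy, x, hx, h⟩ := Sion.exists_isSaddlePointOn' (X := stdSimplex ℝ B)
    (Y := stdSimplex ℝ A) (f := fun y x => F y x)
    ⟨_, single_mem_stdSimplex ℝ (Classical.arbitrary B)⟩ (isCompact_stdSimplex ℝ B)
    (fun x _ => (by fun_prop : Continuous fun y => F.flip x y).lowerSemicontinuous.lowerSemicontinuousOn _)
    (fun x _ => ((F.flip x).convexOn (convex_stdSimplex ℝ B)).quasiconvexOn)
    (convex_stdSimplex ℝ A) (isCompact_stdSimplex ℝ A)
    (fun y _ => (by fun_prop : Continuous fun x => F y x).upperSemicontinuous.upperSemicontinuousOn _)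
    (fun y _ => ((F y).concaveOn (convex_stdSimplex ℝ A)).quasiconcaveOn)
    (convex_stdSimplex ℝ B)
    ⟨_, single_mem_stdSimplex ℝ (Classical.arbitrary A)⟩
  refine ⟨F y x, ⟨x, hx⟩, ⟨y, hy⟩, fun j => ?_, fun i => ?_⟩
  · refine (h _ (single_mem_stdSimplex ℝ j) _ hx).trans_eq ?_
    simp [hF, Pi.single_apply]
  · refine Eq.trans_le ?_ (h _ hy _ (single_mem_stdSimplex ℝ i))
    simp [hF, Pi.single_apply]

theorem sum_mul_sum_stdSimplex_le (p : stdSimplex ℝ A) (q : stdSimplex ℝ B) {c : A → B → ℝ} {C : ℝ}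
    (h : ∀ i j, c i j ≤ C) : ∑ i, ∑ j, p.1 i * q.1 j * c i j ≤ C :=
  (Finset.sum_le_sum fun i _ => Finset.sum_le_sum fun j _ =>
    mul_le_mul_of_nonneg_left (h i j) (mul_nonneg (p.2.1 i) (q.2.1 j))).trans_eq
    (StochasticGame.sum_mul_sum_stdSimplex p q C)

theorem sum_stdSimplex_le (p : stdSimplex ℝ A) {c : A → ℝ} {C : ℝ} (h : ∀ i, c i ≤ C) :
    ∑ i, p.1 i * c i ≤ C := by
  have hp : ∑ i, p.1 i = 1 := p.2.2
  refine (Finset.sum_le_sum fun i _ => mul_le_mul_of_nonneg_left (h i) (p.2.1 i)).trans_eq ?_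
  rw [← Finset.sum_mul, hp, one_mul]

/-- The value of the matrix game `M`. -/
noncomputable def matrixGameValue [Nonempty A] [Nonempty B] (M : A → B → ℝ) : ℝ :=
  (exists_matrixGame_value M).choose

theorem matrixGameValue_spec [Nonempty A] [Nonempty B] (M : A → B → ℝ) :
    ∃ x : stdSimplex ℝ A, ∃ y : stdSimplex ℝ B,
      (∀ j, matrixGameValue M ≤ ∑ i, x.1 i * M i j) ∧ ∀ i, ∑ j, y.1 j * M i j ≤ matrixGameValue M :=
  (exists_matrixGame_value M).choose_spec

/-- Play an optimal `x` of `M` against an optimal `y` of `M'`, and compare the two bilinear payoffs.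
-/
theorem matrixGameValue_le_add [Nonempty A] [Nonempty B] {M M' : A → B → ℝ} {ε : ℝ}
    (h : ∀ i j, M i j ≤ M' i j + ε) : matrixGameValue M ≤ matrixGameValue M' + ε := by
  obtain ⟨x, -, hx, -⟩ := matrixGameValue_spec M
  obtain ⟨-, y, -, hy⟩ := matrixGameValue_spec M'
  have h1 := sum_stdSimplex_le y (c := fun j => matrixGameValue M - ∑ i, x.1 i * M i j) (C := 0)
    fun j => by linarith [hx j]
  have h2 := sum_stdSimplex_le x hy
  have h3 := sum_mul_sum_stdSimplex_le x y (c := fun i j => M i j - M' i j) (C := ε)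
    fun i j => by linarith [h i j]
  have hy1 : ∑ j, y.1 j = 1 := y.2.2
  simp_rw [mul_sub, Finset.sum_sub_distrib] at h1 h3
  rw [← Finset.sum_mul, hy1, one_mul] at h1
  have e1 : ∑ j, y.1 j * ∑ i, x.1 i * M i j = ∑ i, ∑ j, x.1 i * y.1 j * M i j := by
    simp_rw [Finset.mul_sum]
    rw [Finset.sum_comm]
    exact Finset.sum_congr rfl fun i _ => Finset.sum_congr rfl fun j _ => by ring
  have e2 : ∑ i, x.1 i * ∑ j, y.1 j * M' i j = ∑ i, ∑ j, x.1 i * y.1 j * M' i j := by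
    simp_rw [Finset.mul_sum, mul_assoc]
  rw [e1] at h1
  rw [e2] at h2
  linarith

end MatrixGame

/-! ### Solutions of the Shapley equation and their dependence on the discount factor -/

namespace StochasticGame

variable {n : ℕ} {I : Fin n → Type*} {J : Fin n → Type*}
variable [∀ ℓ, Fintype (I ℓ)] [∀ ℓ, Fintype (J ℓ)]

/-- The Shapley operator `Φ` contracts the sup distance by `1 - lam`; the mixed actions are optimal
in the one-shot games at its fixed point. -/
theorem exists_shapleySolution [∀ ℓ, Nonempty (I ℓ)] [∀ ℓ, Nonempty (J ℓ)]
    (G : StochasticGame I J) {lam : ℝ} (h0 : 0 < lam) (h1 : lam ≤ 1) :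
    ∃ f x y, G.ShapleySolution lam f x y := by
  let M : (Fin n → ℝ) → ∀ ℓ, I ℓ → J ℓ → ℝ := fun f ℓ i j =>
    lam * G.g ⟨ℓ, i, j⟩ + (1 - lam) * ∑ ℓ', (G.q ⟨ℓ, i, j⟩).1 ℓ' * f ℓ'
  let Φ : (Fin n → ℝ) → Fin n → ℝ := fun f ℓ => matrixGameValue (M f ℓ)
  have hr : 0 ≤ 1 - lam := by linarith
  have hle : ∀ f f' ℓ, Φ f ℓ ≤ Φ f' ℓ + (1 - lam) * dist f f' := fun f f' ℓ =>
    matrixGameValue_le_add fun i j => by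
      have := sum_stdSimplex_le (G.q ⟨ℓ, i, j⟩) (c := fun ℓ' => f ℓ' - f' ℓ') (C := dist f f')
        fun ℓ' => (le_abs_self _).trans (dist_le_pi_dist f f' ℓ')
      simp_rw [mul_sub, Finset.sum_sub_distrib] at this
      simp only [M]
      nlinarith
  have hc : ContractingWith (Real.toNNReal (1 - lam)) Φ := by
    refine ⟨by rw [Real.toNNReal_lt_one]; linarith, LipschitzWith.of_dist_le_mul fun f f' => ?_⟩
    rw [Real.coe_toNNReal _ hr]
    refine (dist_pi_le_iff (mul_nonneg hr dist_nonneg)).2 fun ℓ => ?_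
    have a := hle f f' ℓ
    have b := hle f' f ℓ
    rw [dist_comm f' f] at b
    rw [Real.dist_eq, abs_le]
    constructor <;> linarith
  obtain ⟨f, hf, -⟩ := hc.exists_fixedPoint 0 (edist_ne_top _ _)
  choose x y hx hy using fun ℓ => matrixGameValue_spec (M f ℓ)
  have hfix : ∀ ℓ, matrixGameValue (M f ℓ) = f ℓ := fun ℓ => congrFun hf ℓ
  refine ⟨f, x, y, fun ℓ j => ?_, fun ℓ i => ?_⟩
  · have h := hx ℓ j
    have e : ∑ i, (x ℓ).1 i * f ℓ = f ℓ := by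
      rw [← Finset.sum_mul]
      exact (congrArg (· * f ℓ) (x ℓ).2.2).trans (one_mul _)
    rw [hfix] at h
    simp only [defect, mul_sub (_ : ℝ) _ (f ℓ), Finset.sum_sub_distrib]
    rw [e]
    exact sub_nonneg.2 h
  · have h := hy ℓ i
    have e : ∑ j, (y ℓ).1 j * f ℓ = f ℓ := by
      rw [← Finset.sum_mul]
      exact (congrArg (· * f ℓ) (y ℓ).2.2).trans (one_mul _)
    rw [hfix] at h
    simp only [defect, mul_sub (_ : ℝ) _ (f ℓ), Finset.sum_sub_distrib]
    rw [e]
    exact sub_nonpos.2 h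

/-- At a state maximising `f - f'`, play `x` against `y'`: the averaged defect of `f` is nonnegative
and that of `f'` nonpositive. Changing the discount factor costs at most `|lam - lam'|` in the stage
payoff and as much in the continuation payoff, while maximality of the state supplies `-lam * (f -
f')`. -/
theorem ShapleySolution.sub_le {G : StochasticGame I J} {lam lam' : ℝ} {f f' : Fin n → ℝ}
    {x x' : ∀ ℓ, stdSimplex ℝ (I ℓ)} {y y' : ∀ ℓ, stdSimplex ℝ (J ℓ)}
    (hf : G.ShapleySolution lam f x y) (hf' : G.ShapleySolution lam' f' x' y')
    (h0 : 0 < lam) (h1 : lam ≤ 1) (hg : ∀ z, G.g z ∈ Set.Icc (0 : ℝ) 1)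
    (hI : ∀ ℓ, f' ℓ ∈ Set.Icc (0 : ℝ) 1) (k : Fin n) :
    lam * (f k - f' k) ≤ 2 * |lam - lam'| := by
  obtain ⟨ℓ, -, hℓ⟩ := Finset.exists_max_image Finset.univ (fun ℓ => f ℓ - f' ℓ) ⟨k, Finset.mem_univ k⟩
  have hℓ' : ∀ ℓ', f ℓ' - f' ℓ' ≤ f ℓ - f' ℓ := fun ℓ' => hℓ ℓ' (Finset.mem_univ _)
  have key := sum_mul_sum_stdSimplex_le (x ℓ) (y' ℓ)
    (c := fun i j => G.defect lam f ⟨ℓ, i, j⟩ - G.defect lam' f' ⟨ℓ, i, j⟩)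
    (C := 2 * |lam - lam'| - lam * (f ℓ - f' ℓ)) fun i j => by
      have a := sum_stdSimplex_le (G.q ⟨ℓ, i, j⟩) hℓ'
      have b := sum_stdSimplex_le (G.q ⟨ℓ, i, j⟩) fun ℓ => (hI ℓ).2
      have c : 0 ≤ ∑ ℓ', (G.q ⟨ℓ, i, j⟩).1 ℓ' * f' ℓ' :=
        Finset.sum_nonneg fun ℓ' _ => mul_nonneg ((G.q _).2.1 ℓ') (hI ℓ').1
      simp_rw [mul_sub, Finset.sum_sub_distrib] at a
      obtain ⟨g0, g1⟩ := hg ⟨ℓ, i, j⟩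
      have d1 : (lam - lam') * G.g ⟨ℓ, i, j⟩ ≤ |lam - lam'| := by
        refine (le_abs_self _).trans ?_
        rw [abs_mul, abs_of_nonneg g0]
        exact mul_le_of_le_one_right (abs_nonneg _) g1
      have d2 : (lam' - lam) * ∑ ℓ', (G.q ⟨ℓ, i, j⟩).1 ℓ' * f' ℓ' ≤ |lam - lam'| := by
        refine (le_abs_self _).trans ?_
        rw [abs_mul, abs_of_nonneg c, abs_sub_comm]
        exact mul_le_of_le_one_right (abs_nonneg _) b
      have d3 := mul_le_mul_of_nonneg_left a (by linarith : 0 ≤ 1 - lam)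
      simp only [defect]
      linarith
  have p1 : 0 ≤ ∑ i, ∑ j, (x ℓ).1 i * (y' ℓ).1 j * G.defect lam f ⟨ℓ, i, j⟩ := by
    rw [Finset.sum_comm]
    refine Finset.sum_nonneg fun j _ => ?_
    have := mul_nonneg ((y' ℓ).2.1 j) (hf.left ℓ j)
    rw [Finset.mul_sum] at this
    exact this.trans_eq (Finset.sum_congr rfl fun i _ => by ring)
  have p2 : ∑ i, ∑ j, (x ℓ).1 i * (y' ℓ).1 j * G.defect lam' f' ⟨ℓ, i, j⟩ ≤ 0 := by
    refine Finset.sum_nonpos fun i _ => ?_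
    have := mul_nonpos_of_nonneg_of_nonpos ((x ℓ).2.1 i) (hf'.right ℓ i)
    rw [Finset.mul_sum] at this
    exact (Finset.sum_congr rfl fun i _ => by ring).trans_le this
  simp_rw [mul_sub, Finset.sum_sub_distrib] at key
  have := mul_le_mul_of_nonneg_left (hℓ' k) h0.le
  linarith

theorem continuousOn_lowerValue [∀ ℓ, Nonempty (I ℓ)] [∀ ℓ, Nonempty (J ℓ)]
    (G : StochasticGame I J) (hg : ∀ z, G.g z ∈ Set.Icc (0 : ℝ) 1) (k : Fin n) :
    ContinuousOn (fun lam => G.lowerValue lam k) (Set.Ioc 0 1) := by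
  intro lam hlam
  have key : ∀ lam' ∈ Set.Ioc (0 : ℝ) 1,
      |G.lowerValue lam' k - G.lowerValue lam k| ≤ 2 / min lam lam' * |lam' - lam| := by
    intro lam' hlam'
    obtain ⟨f, x, y, hf⟩ := G.exists_shapleySolution hlam.1 hlam.2
    obtain ⟨f', x', y', hf'⟩ := G.exists_shapleySolution hlam'.1 hlam'.2
    rw [← (hf.isValue hlam.1 hlam.2 hg k).1, ← (hf'.isValue hlam'.1 hlam'.2 hg k).1]
    have a := hf.sub_le hf' hlam.1 hlam.2 hg (hf'.mem_Icc hlam'.1 hlam'.2 hg) k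
    have b := hf'.sub_le hf hlam'.1 hlam'.2 hg (hf.mem_Icc hlam.1 hlam.2 hg) k
    rw [abs_sub_comm] at a
    have hm : 0 < min lam lam' := lt_min hlam.1 hlam'.1
    rw [div_mul_eq_mul_div, le_div_iff₀ hm]
    rcases abs_cases (f' k - f k) with ⟨e, h⟩ | ⟨e, h⟩ <;> rw [e]
    · nlinarith [min_le_right lam lam']
    · nlinarith [min_le_left lam lam']
  rw [ContinuousWithinAt, tendsto_iff_dist_tendsto_zero]
  have ht : Tendsto (fun lam' => 2 / min lam lam' * |lam' - lam|) (𝓝[Set.Ioc 0 1] lam)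
      (𝓝 (2 / min lam lam * |lam - lam|)) := by
    refine Tendsto.mono_left (ContinuousAt.tendsto ?_) nhdsWithin_le_nhds
    have : min lam lam ≠ 0 := by rw [min_self]; exact hlam.1.ne'
    fun_prop (disch := assumption)
  rw [sub_self, abs_zero, mul_zero] at ht
  exact squeeze_zero' (Eventually.of_forall fun _ => dist_nonneg)
    (eventually_nhdsWithin_of_forall fun lam' h => by rw [Real.dist_eq]; exact key lam' h) ht

end StochasticGame

/-! ### Singular kernels of one-parameter matrix games -/

section Kernel

open Matrix

variable {R C : Type*} [Fintype R] [Fintype C]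

/-- A direction along which no active constraint changes leads to a point with more active
constraints. -/
theorem exists_card_ne_zero_lt {ι : Type*} [Fintype ι] {s e : ι → ℝ}
    (hs : 0 ≤ s) (he : ∀ c, s c = 0 → e c = 0) (hneg : ∃ c, e c < 0) :
    ∃ t : ℝ, 0 ≤ s + t • e ∧
      (Finset.univ.filter fun c => (s + t • e) c ≠ 0).card <
        (Finset.univ.filter fun c => s c ≠ 0).card := by
  -- Ratio test of the simplex method: `c` is the first coordinate to reach zero along `e`.
  obtain ⟨c, hc, hmin⟩ := Finset.exists_min_image (Finset.univ.filter fun c => e c < 0)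
    (fun c => s c / -e c) (by obtain ⟨c, hc⟩ := hneg; exact ⟨c, by simpa using hc⟩)
  have hec : e c < 0 := by simpa using hc
  refine ⟨s c / -e c, fun c' => ?_, Finset.card_lt_card ?_⟩
  · simp only [Pi.zero_apply, Pi.add_apply, Pi.smul_apply, smul_eq_mul]
    rcases lt_or_ge (e c') 0 with h | h
    · have := hmin c' (by simpa using h)
      rw [le_div_iff₀ (by linarith)] at this
      linarith
    · have : 0 ≤ s c / -e c * e c' := mul_nonneg (div_nonneg (hs c) (by linarith)) h
      linarith [show 0 ≤ s c' from hs c']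
  · rw [Finset.ssubset_iff_of_subset]
    · refine ⟨c, ?_, ?_⟩
      · simp only [Finset.mem_filter, Finset.mem_univ, true_and]
        exact fun h => hec.ne (he c h)
      · have : s c + s c / -e c * e c = 0 := by
          rw [div_neg, neg_mul, div_mul_cancel₀ _ hec.ne, add_neg_cancel]
        simpa using this
    · intro c'
      simp only [Finset.mem_filter, Finset.mem_univ, true_and, Pi.add_apply, Pi.smul_apply,
        smul_eq_mul]
      intro h h0
      exact h (by rw [h0, he c' h0]; ring)

/-- Columns of a matrix with linearly independent rows can be selected to form an invertible
matrix. -/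
theorem exists_det_submatrix_ne_zero {S T : Type*} [Fintype S] [DecidableEq S] [Finite T]
    (W : Matrix S T ℝ) (hW : ∀ d : S → ℝ, (∀ j, ∑ i, d i * W i j = 0) → d = 0) :
    ∃ c : S → T, (W.submatrix id c).det ≠ 0 := by
  have := Fintype.ofFinite T
  have hli : LinearIndependent ℝ W.row := by
    rw [Fintype.linearIndependent_iff]
    intro d hd
    refine congrFun (hW d fun j => ?_)
    have := congrFun hd j
    simpa [Finset.sum_apply] using this
  have hrank : Module.finrank ℝ (Submodule.span ℝ (Set.range W.col)) = Fintype.card S := by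
    rw [← hli.rank_matrix, Matrix.rank_eq_finrank_span_cols]
  have hspan : Submodule.span ℝ (Set.range W.col) = ⊤ :=
    Submodule.eq_top_of_finrank_eq (by rw [hrank, Module.finrank_fintype_fun_eq_card])
  obtain ⟨κ, a, -, ha, hκ⟩ := exists_linearIndependent' ℝ W.col
  have : Fintype κ := @Fintype.ofFinite _ hκ.finite
  have hcard : Fintype.card S = Fintype.card κ := by
    rw [← hrank, ← ha, finrank_span_eq_card hκ]
  let e := Fintype.equivOfCardEq hcard
  refine ⟨a ∘ e, fun h => ?_⟩
  have hc : LinearIndependent ℝ (W.submatrix id (a ∘ e)).col := hκ.comp e e.injective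
  rw [Matrix.linearIndependent_cols_iff_isUnit, Matrix.isUnit_iff_isUnit_det] at hc
  exact hc.ne_zero h

/-- A feasible point with the fewest nonzero slacks is a vertex of the polyhedron. No nonzero
direction preserves all its active constraints, so the rows of its support, restricted to the tight
columns, are independent, and a square nonsingular block can be selected. -/
theorem exists_vertex [DecidableEq R] (W : R → C → ℝ) {x : R → ℝ} (hx : 0 ≤ x)
    (hW : ∀ j, 1 ≤ ∑ i, x i * W i j) :
    ∃ x' : R → ℝ, 0 ≤ x' ∧ (∀ j, 1 ≤ ∑ i, x' i * W i j) ∧ ∃ (S : Finset R) (c : S → C),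
      (∀ i ∉ S, x' i = 0) ∧ (∀ s, ∑ i, x' i * W i (c s) = 1) ∧
        (Matrix.of fun s t : S => W s (c t)).det ≠ 0 := by
  classical
  let slack : (R → ℝ) → R ⊕ C → ℝ := fun x => Sum.elim x fun j => ∑ i, x i * W i j - 1
  let N : (R → ℝ) → ℕ := fun x => (Finset.univ.filter fun c => slack x c ≠ 0).card
  have hfeas : ∀ x, 0 ≤ slack x ↔ 0 ≤ x ∧ ∀ j, 1 ≤ ∑ i, x i * W i j := by
    intro x
    constructor
    · exact fun h => ⟨fun i => h (Sum.inl i), fun j => sub_nonneg.1 (h (Sum.inr j))⟩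
    · rintro ⟨h1, h2⟩ (i | j)
      · exact h1 i
      · exact sub_nonneg.2 (h2 j)
  have hne : {x | 0 ≤ slack x}.Nonempty := ⟨x, (hfeas x).2 ⟨hx, hW⟩⟩
  set z := Function.argminOn N {x | 0 ≤ slack x} hne with hz
  have hz0 : 0 ≤ slack z := Function.argminOn_mem N _ hne
  have hzmin : ∀ x, 0 ≤ slack x → N z ≤ N x := fun x h => Function.argminOn_le N _ h
  obtain ⟨h1, h2⟩ := (hfeas z).1 hz0
  let S := Finset.univ.filter fun i => z i ≠ 0
  let T := {j : C // ∑ i, z i * W i j = 1}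
  -- Moving along a direction with a negative coordinate would activate another constraint. Applying
  -- this to both `d` and `-d` will force `d = 0`.
  have hdir : ∀ d : R → ℝ, (∀ i, z i = 0 → d i = 0) →
      (∀ j, ∑ i, z i * W i j = 1 → ∑ i, d i * W i j = 0) → ∀ i, ¬ d i < 0 := by
    intro d hd1 hd2 i hi
    obtain ⟨t, ht1, ht2⟩ := exists_card_ne_zero_lt (s := slack z)
      (e := Sum.elim d fun j => ∑ i, d i * W i j) hz0 (by
        rintro (i | j) h
        · exact hd1 i h
        · exact hd2 j (sub_eq_zero.1 h)) ⟨Sum.inl i, hi⟩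
    have e : slack z + t • (Sum.elim d fun j => ∑ i, d i * W i j) = slack (z + t • d) := by
      funext c
      rcases c with i | j
      · simp [slack]
      · simp only [slack, Pi.add_apply, Pi.smul_apply, Sum.elim_inr, smul_eq_mul, add_mul,
          Finset.sum_add_distrib, mul_assoc, Finset.mul_sum]
        ring
    rw [e] at ht1 ht2
    exact absurd (hzmin _ ht1) (not_le.2 ht2)
  obtain ⟨c, hc⟩ := exists_det_submatrix_ne_zero (S := S) (T := T)
    (Matrix.of fun i j => W i j) (by
      intro d hd
      let d' : R → ℝ := fun i => if h : i ∈ S then d ⟨i, h⟩ else 0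
      have hS : ∀ i, z i = 0 → i ∉ S := fun i h hi => (Finset.mem_filter.1 hi).2 h
      have hsum : ∀ j, ∑ i, d' i * W i j = ∑ i : S, d i * W i j := by
        intro j
        rw [← Finset.sum_subset (Finset.subset_univ S), ← Finset.sum_coe_sort]
        · exact Finset.sum_congr rfl fun i _ => by simp [d']
        · intro i _ hi
          simp [d', hi]
      have a := hdir d' (fun i h => dif_neg (hS i h)) (fun j hj => by
        rw [hsum]; exact hd ⟨j, hj⟩)
      have b := hdir (-d') (fun i h => neg_eq_zero.2 (dif_neg (hS i h))) (fun j hj => by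
        simp only [Pi.neg_apply, neg_mul, Finset.sum_neg_distrib, hsum, neg_eq_zero]
        exact hd ⟨j, hj⟩)
      funext i
      have a' := a i
      have b' := b i
      have : d' i = d i := by simp [d']
      simp only [Pi.neg_apply] at b'
      rw [this] at a' b'
      exact le_antisymm (neg_nonneg.1 (not_lt.1 b')) (not_lt.1 a'))
  refine ⟨z, h1, h2, S, fun s => (c s).1, fun i hi => ?_, fun s => (c s).2, hc⟩
  by_contra h
  exact hi (Finset.mem_filter.2 ⟨Finset.mem_univ _, h⟩)

/-- A kernel of the one-parameter family of matrix games `A - z B` at its zero `v`. -/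
theorem exists_singular_kernel [DecidableEq R] [Nonempty C] (A B : R → C → ℝ) (hB : ∀ i j, 0 < B i j) (v : ℝ)
    {x : R → ℝ} (hx : 0 ≤ x) (hx0 : x ≠ 0) (hxW : ∀ j, 0 ≤ ∑ i, x i * (A i j - v * B i j))
    {y : C → ℝ} (hy : 0 ≤ y) (hy1 : ∑ j, y j = 1) (hyW : ∀ i, ∑ j, y j * (A i j - v * B i j) ≤ 0) :
    ∃ (S : Finset R) (c : S → C),
      (Matrix.of fun s t : S => A s (c t) - v * B s (c t)).det = 0 ∧
        ∃ z, (Matrix.of fun s t : S => A s (c t) - z * B s (c t)).det ≠ 0 := by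
  classical
  let W : ∀ p : (Σ S : Finset R, (S → C)), ℝ → Matrix p.1 p.1 ℝ := fun p z =>
    Matrix.of fun s t => A s (p.2 t) - z * B s (p.2 t)
  have hWc : ∀ p, Continuous (W p) := by
    intro p
    refine continuous_matrix fun s t => ?_
    change Continuous fun z => A s (p.2 t) - z * B s (p.2 t)
    fun_prop
  obtain ⟨b, hb⟩ := (Set.finite_range fun p : R × C => B p.1 p.2).bddAbove
  have hb' : ∀ i j, B i j ≤ b := fun i j => hb ⟨(i, j), rfl⟩
  -- By Cramer's rule, for a vertex with kernel `p`, `F p z` is the determinant times the total mass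
  -- of the vertex.
  let F : (Σ S : Finset R, (S → C)) → ℝ → ℝ := fun p z => ∑ s, ∑ t, (W p z).adjugate t s
  have hFc : ∀ p, Continuous (F p) := fun p =>
    continuous_finsetSum _ fun s _ => continuous_finsetSum _ fun t _ =>
      (hWc p).matrix_adjugate.matrix_elem t s
  -- For `z < v` the strategy `x` earns a positive payoff, so a normalised vertex exists. The
  -- strategy `y` keeps the value below `(v - z) * b`, which forces the mass of the vertex to be at
  -- least the inverse of this quantity.
  have hex : ∀ z < v, ∃ p, (W p z).det ≠ 0 ∧ |(W p z).det| ≤ (v - z) * b * |F p z| := by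
    intro z hz
    have hpos : ∀ j, 0 < ∑ i, x i * (A i j - z * B i j) := by
      intro j
      have h1 : 0 < ∑ i, x i * B i j := by
        obtain ⟨i, hi⟩ := Function.ne_iff.1 hx0
        exact Finset.sum_pos' (fun i _ => mul_nonneg (hx i) (hB i j).le)
          ⟨i, Finset.mem_univ _, mul_pos (lt_of_le_of_ne (hx i) (Ne.symm hi)) (hB i j)⟩
      have h2 : ∑ i, x i * (A i j - z * B i j) =
          ∑ i, x i * (A i j - v * B i j) + (v - z) * ∑ i, x i * B i j := by
        rw [Finset.mul_sum, ← Finset.sum_add_distrib]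
        exact Finset.sum_congr rfl fun i _ => by ring
      rw [h2]
      have := mul_pos (sub_pos.2 hz) h1
      linarith [hxW j]
    obtain ⟨j₀, -, hj₀⟩ := Finset.exists_min_image Finset.univ
      (fun j => ∑ i, x i * (A i j - z * B i j)) Finset.univ_nonempty
    set m := ∑ i, x i * (A i j₀ - z * B i j₀)
    have hm : 0 < m := hpos j₀
    obtain ⟨x', hx', hxW', S, c, hS, hc, hdet⟩ := exists_vertex (fun i j => A i j - z * B i j)
      -- Dividing by the worst column payoff makes every column payoff at least `1`.
      (x := m⁻¹ • x) (smul_nonneg (inv_nonneg.2 hm.le) hx) (fun j => by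
        simp only [Pi.smul_apply, smul_eq_mul, mul_assoc, ← Finset.mul_sum]
        rw [← div_eq_inv_mul, le_div_iff₀ hm, one_mul]
        exact hj₀ j (Finset.mem_univ _))
    refine ⟨⟨S, c⟩, hdet, ?_⟩
    have hsum : 1 ≤ (v - z) * b * ∑ i, x' i := by
      calc (1 : ℝ) = ∑ j, y j * 1 := by simp [hy1]
        _ ≤ ∑ j, y j * ∑ i, x' i * (A i j - z * B i j) :=
            Finset.sum_le_sum fun j _ => mul_le_mul_of_nonneg_left (hxW' j) (hy j)
        _ = ∑ i, x' i * ∑ j, y j * (A i j - z * B i j) := by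
            simp_rw [Finset.mul_sum]
            rw [Finset.sum_comm]
            exact Finset.sum_congr rfl fun i _ => Finset.sum_congr rfl fun j _ => by ring
        _ ≤ ∑ i, x' i * ((v - z) * b) := by
            refine Finset.sum_le_sum fun i _ => mul_le_mul_of_nonneg_left ?_ (hx' i)
            have e : ∑ j, y j * (A i j - z * B i j) =
                ∑ j, y j * (A i j - v * B i j) + (v - z) * ∑ j, y j * B i j := by
              rw [Finset.mul_sum, ← Finset.sum_add_distrib]
              exact Finset.sum_congr rfl fun i _ => by ring
            have e2 : ∑ j, y j * B i j ≤ b := by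
              calc _ ≤ ∑ j, y j * b :=
                    Finset.sum_le_sum fun j _ => mul_le_mul_of_nonneg_left (hb' i j) (hy j)
                _ = b := by rw [← Finset.sum_mul, hy1, one_mul]
            rw [e]
            have := mul_le_mul_of_nonneg_left e2 (sub_pos.2 hz).le
            linarith [hyW i]
        _ = (v - z) * b * ∑ i, x' i := by rw [← Finset.sum_mul, mul_comm]
    have hvec : (fun s : S => x' s) ᵥ* W ⟨S, c⟩ z = fun _ => 1 := by
      funext t
      rw [← hc t, ← Finset.sum_subset (Finset.subset_univ S), ← Finset.sum_coe_sort]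
      · rfl
      · intro i _ hi
        rw [hS i hi, zero_mul]
    have hadj : (W ⟨S, c⟩ z).det * ∑ i, x' i = F ⟨S, c⟩ z := by
      have h := congrArg (· ᵥ* (W ⟨S, c⟩ z).adjugate) hvec
      simp only [Matrix.vecMul_vecMul, Matrix.mul_adjugate, Matrix.vecMul_smul,
        Matrix.vecMul_one] at h
      have e : ∑ i, x' i = ∑ s : S, x' s := by
        rw [← Finset.sum_subset (Finset.subset_univ S), ← Finset.sum_coe_sort]
        exact fun i _ hi => hS i hi
      rw [e, Finset.mul_sum]
      refine Finset.sum_congr rfl fun s _ => ?_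
      have := congrFun h s
      simpa [Matrix.vecMul, dotProduct] using this
    have h0 : 0 ≤ ∑ i, x' i := Finset.sum_nonneg fun i _ => hx' i
    have habs : |F ⟨S, c⟩ z| = |(W ⟨S, c⟩ z).det| * ∑ i, x' i := by
      rw [← hadj, abs_mul, abs_of_nonneg h0]
    rw [habs]
    nlinarith [abs_nonneg (W ⟨S, c⟩ z).det]
  -- Since there are finitely many kernels, a single one serves for values of `z` arbitrarily close
  -- to `v` from below.
  obtain ⟨p, hp⟩ : ∃ p, ∃ᶠ z in 𝓝[<] v,
      (W p z).det ≠ 0 ∧ |(W p z).det| ≤ (v - z) * b * |F p z| := by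
    by_contra h
    simp only [not_exists, not_frequently] at h
    obtain ⟨z, hz, hz'⟩ := ((eventually_all.2 h).and self_mem_nhdsWithin).exists
    obtain ⟨p, hp⟩ := hex z hz'
    exact hz p hp
  refine ⟨p.1, p.2, ?_, ?_⟩
  · change (W p v).det = 0
    by_contra h
    -- `F p` is continuous, hence bounded near `v`, so the bound by `(v - z) * b * |F p z|` forces
    -- the determinant to vanish at `v`.
    have hcont : Continuous fun z => |(W p z).det| - (v - z) * b * |F p z| :=
      (hWc p).matrix_det.abs.sub (((continuous_const.sub continuous_id).mul continuous_const).mul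
        (hFc p).abs)
    have hlt : 0 < |(W p v).det| - (v - v) * b * |F p v| := by simpa using h
    have hev : ∀ᶠ z in 𝓝[<] v, 0 < |(W p z).det| - (v - z) * b * |F p z| :=
      nhdsWithin_le_nhds (hcont.continuousAt.eventually (lt_mem_nhds hlt))
    obtain ⟨z, ⟨-, h1⟩, h2⟩ := (hp.and_eventually hev).exists
    linarith
  · obtain ⟨z, hz, -⟩ := hp.exists
    exact ⟨z, hz⟩

end Kernel

/-! ### Coefficient sums of integer polynomials and their zeros near the origin -/

namespace MvPolynomial

variable {τ : Type*}

/-- The sum of the absolute values of the coefficients of an integer polynomial. -/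
def l1 (p : MvPolynomial τ ℤ) : ℕ := ∑ m ∈ p.support, (p.coeff m).natAbs

theorem l1_eq_sum {p : MvPolynomial τ ℤ} {s : Finset (τ →₀ ℕ)} (h : p.support ⊆ s) :
    p.l1 = ∑ m ∈ s, (p.coeff m).natAbs :=
  Finset.sum_subset h fun m _ hm => by rw [notMem_support_iff.1 hm, Int.natAbs_zero]

theorem l1_add_le (p q : MvPolynomial τ ℤ) : (p + q).l1 ≤ p.l1 + q.l1 := by
  classical
  rw [l1_eq_sum (support_add (p := p) (q := q)),
    l1_eq_sum (Finset.subset_union_left (s₁ := p.support) (s₂ := q.support)),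
    l1_eq_sum (Finset.subset_union_right (s₁ := p.support) (s₂ := q.support)),
    ← Finset.sum_add_distrib]
  exact Finset.sum_le_sum fun m _ => by rw [coeff_add]; exact Int.natAbs_add_le _ _

@[simp] theorem l1_zero : (0 : MvPolynomial τ ℤ).l1 = 0 := by simp [l1]

theorem l1_monomial_le (m : τ →₀ ℕ) (c : ℤ) : (monomial m c).l1 ≤ c.natAbs := by
  classical
  rw [l1_eq_sum (support_monomial_subset (s := m) (a := c))]
  simp

theorem l1_neg (p : MvPolynomial τ ℤ) : (-p).l1 = p.l1 := by
  simp [l1, support_neg]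

theorem l1_sub_le (p q : MvPolynomial τ ℤ) : (p - q).l1 ≤ p.l1 + q.l1 := by
  rw [sub_eq_add_neg]
  exact (l1_add_le _ _).trans_eq (by rw [l1_neg])

theorem l1_sum_le {ι : Type*} (s : Finset ι) (f : ι → MvPolynomial τ ℤ) :
    (∑ i ∈ s, f i).l1 ≤ ∑ i ∈ s, (f i).l1 :=
  Finset.le_sum_of_subadditive _ l1_zero.le l1_add_le s f

theorem l1_mul_le (p q : MvPolynomial τ ℤ) : (p * q).l1 ≤ p.l1 * q.l1 := by
  have e : p * q = ∑ m ∈ p.support, ∑ m' ∈ q.support,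
      monomial (m + m') (p.coeff m * q.coeff m') := by
    conv_lhs => rw [p.as_sum, q.as_sum, Finset.sum_mul_sum]
    simp_rw [monomial_mul]
  rw [e, l1.eq_def p, l1.eq_def q, Finset.sum_mul_sum]
  refine (l1_sum_le _ _).trans (Finset.sum_le_sum fun m _ => (l1_sum_le _ _).trans
    (Finset.sum_le_sum fun m' _ => (l1_monomial_le _ _).trans_eq (Int.natAbs_mul _ _)))

theorem l1_C_le (c : ℤ) : (C c : MvPolynomial τ ℤ).l1 ≤ c.natAbs := l1_monomial_le 0 c

theorem l1_X_le (i : τ) : (X i : MvPolynomial τ ℤ).l1 ≤ 1 := l1_monomial_le _ 1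

theorem l1_prod_le {ι : Type*} (s : Finset ι) (f : ι → MvPolynomial τ ℤ) :
    (∏ i ∈ s, f i).l1 ≤ ∏ i ∈ s, (f i).l1 := by
  classical
  induction s using Finset.induction_on with
  | empty => simpa using l1_C_le (τ := τ) 1
  | insert a s ha ih =>
    rw [Finset.prod_insert ha, Finset.prod_insert ha]
    exact (l1_mul_le _ _).trans (Nat.mul_le_mul_left _ ih)

/-- The permutations are among the functions indexing the expansion of the product of row sums. -/
theorem l1_det_le {ι : Type*} [Fintype ι] [DecidableEq ι] (M : Matrix ι ι (MvPolynomial τ ℤ)) :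
    M.det.l1 ≤ ∏ i, ∑ j, (M i j).l1 := by
  rw [← Matrix.det_transpose, Matrix.det_apply, Finset.prod_univ_sum, Fintype.piFinset_univ]
  calc _ ≤ ∑ σ : Equiv.Perm ι, ∏ i, (M i (σ i)).l1 := by
        refine (l1_sum_le _ _).trans (Finset.sum_le_sum fun σ _ => ?_)
        refine le_trans (le_of_eq ?_) (l1_prod_le _ _)
        rcases Int.units_eq_one_or (Equiv.Perm.sign σ) with h | h <;> simp [h, l1_neg]
    _ = ∑ f ∈ Finset.univ.map ⟨fun σ : Equiv.Perm ι => (σ : ι → ι), DFunLike.coe_injective⟩,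
          ∏ i, (M i (f i)).l1 := by rw [Finset.sum_map]; rfl
    _ ≤ _ := Finset.sum_le_sum_of_subset (Finset.subset_univ _)

/-- A nonzero integer polynomial in two variables has no zero `(w, z)` with `0 < w ≪ z ≪ 1`. -/
theorem aeval_ne_zero_of_small {p : MvPolynomial (Fin 2) ℤ} (hp : p ≠ 0) {H D : ℕ} {w z : ℝ}
    (hH : p.l1 ≤ H) (hD : p.degreeOf 1 ≤ D) (hw : 0 < w) (hw1 : w ≤ 1) (hz : 0 < z) (hz1 : z ≤ 1)
    (hHz : H * z < 1) (hHw : H * w < z ^ D) : aeval ![w, z] p ≠ 0 := by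
  -- The dominant monomial: least exponent of `w`, then least exponent of `z`.
  obtain ⟨m₀, hm₀, hmin⟩ := Finset.exists_min_image p.support
    (fun m => toLex (m 0, m 1)) (support_nonempty.2 hp)
  have hlex : ∀ m ∈ p.support, m ≠ m₀ → m₀ 0 + 1 ≤ m 0 ∨ (m₀ 0 = m 0 ∧ m₀ 1 + 1 ≤ m 1) := by
    intro m hm hne
    have h := hmin m hm
    rw [Prod.Lex.toLex_le_toLex] at h
    rcases h with h | ⟨h, h'⟩
    · exact Or.inl h
    · refine Or.inr ⟨h, lt_of_le_of_ne h' fun h'' => hne ?_⟩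
      ext i
      fin_cases i
      · exact h.symm
      · exact h''.symm
  -- Every other monomial is at most `ρ` times the dominant one: it has an extra factor `z`, or an
  -- extra factor `w` at the price of at most `D` powers of `z`.
  set ρ := max z (w / z ^ D) with hρ
  have hzD : 0 < z ^ D := pow_pos hz D
  have hHρ : H * ρ < 1 := by
    rcases max_choice z (w / z ^ D) with h | h <;> rw [hρ, h]
    · exact hHz
    · rwa [← mul_div_assoc, div_lt_one hzD]
  have hρ0 : 0 < ρ := lt_max_of_lt_left hz
  set t : (Fin 2 →₀ ℕ) → ℝ := fun m => w ^ m 0 * z ^ m 1 with ht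
  have ht0 : ∀ m, 0 < t m := fun m => mul_pos (pow_pos hw _) (pow_pos hz _)
  have hsD : z ^ D ≤ z ^ m₀ 1 :=
    pow_le_pow_of_le_one hz.le hz1 ((monomial_le_degreeOf 1 hm₀).trans hD)
  have htm : ∀ m ∈ p.support, m ≠ m₀ → t m ≤ t m₀ * ρ := by
    intro m hm hne
    rcases hlex m hm hne with h | ⟨h, h'⟩
    · calc t m ≤ w ^ (m₀ 0 + 1) * 1 := mul_le_mul (pow_le_pow_of_le_one hw.le hw1 h)
            (pow_le_one₀ hz.le hz1) (pow_pos hz _).le (pow_pos hw _).le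
        _ = w ^ m₀ 0 * (z ^ D * (w / z ^ D)) := by
            rw [mul_div_cancel₀ _ hzD.ne', mul_one, pow_succ]
        _ ≤ w ^ m₀ 0 * (z ^ m₀ 1 * ρ) := by
            refine mul_le_mul_of_nonneg_left (mul_le_mul hsD (le_max_right _ _) ?_ ?_)
              (pow_pos hw _).le
            · exact div_nonneg hw.le hzD.le
            · exact (pow_pos hz _).le
        _ = t m₀ * ρ := by rw [ht]; ring
    · calc t m ≤ w ^ m₀ 0 * z ^ (m₀ 1 + 1) := by
            rw [ht, h]
            exact mul_le_mul_of_nonneg_left (pow_le_pow_of_le_one hz.le hz1 h') (pow_pos hw _).le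
        _ = t m₀ * z := by rw [ht, pow_succ]; ring
        _ ≤ t m₀ * ρ := mul_le_mul_of_nonneg_left (le_max_left _ _) (ht0 _).le
  have heval : aeval ![w, z] p = ∑ m ∈ p.support, ((p.coeff m : ℤ) : ℝ) * t m := by
    rw [aeval_def, eval₂_eq']
    simp [ht, Fin.prod_univ_two]
  intro h0
  rw [heval, ← Finset.add_sum_erase _ _ hm₀] at h0
  have hrest : |∑ m ∈ p.support.erase m₀, ((p.coeff m : ℤ) : ℝ) * t m| < t m₀ := by
    calc _ ≤ ∑ m ∈ p.support.erase m₀, |((p.coeff m : ℤ) : ℝ)| * (t m₀ * ρ) := by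
          refine (Finset.abs_sum_le_sum_abs _ _).trans (Finset.sum_le_sum fun m hm => ?_)
          rw [abs_mul, abs_of_pos (ht0 m)]
          exact mul_le_mul_of_nonneg_left
            (htm m (Finset.mem_of_mem_erase hm) (Finset.ne_of_mem_erase hm)) (abs_nonneg _)
      _ ≤ ∑ m ∈ p.support, |((p.coeff m : ℤ) : ℝ)| * (t m₀ * ρ) :=
          Finset.sum_le_sum_of_subset_of_nonneg (Finset.erase_subset _ _) fun m _ _ =>
            mul_nonneg (abs_nonneg _) (mul_pos (ht0 _) hρ0).le
      _ = p.l1 * (t m₀ * ρ) := by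
          rw [← Finset.sum_mul, l1]
          push_cast [Nat.cast_natAbs]
          rfl
      _ ≤ H * (t m₀ * ρ) :=
          mul_le_mul_of_nonneg_right (by exact_mod_cast hH) (mul_pos (ht0 _) hρ0).le
      _ = (H * ρ) * t m₀ := by ring
      _ < 1 * t m₀ := mul_lt_mul_of_pos_right hHρ (ht0 _)
      _ = t m₀ := one_mul _
  have hc : (1 : ℝ) ≤ |((p.coeff m₀ : ℤ) : ℝ)| := by
    exact_mod_cast Int.one_le_abs (mem_support_iff.1 hm₀)
  have : t m₀ ≤ |((p.coeff m₀ : ℤ) : ℝ) * t m₀| := by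
    rw [abs_mul, abs_of_pos (ht0 _)]
    exact le_mul_of_one_le_left (ht0 _).le hc
  rw [eq_neg_of_add_eq_zero_left h0, abs_neg] at this
  linarith

end MvPolynomial

/-! ### Determinants attached to stochastic matrices -/

section Stochastic

open Matrix

variable {ι : Type*} [Fintype ι] [DecidableEq ι]

/-- Minimum principle: at a minimal coordinate `i` the average of `h` under `Q i` is at least `h i`,
so the hypothesis gives `(1 - t) * h i ≥ 0`. -/
theorem nonneg_of_one_sub_smul_mulVec_nonneg {Q : Matrix ι ι ℝ} (hQ : ∀ i, Q i ∈ stdSimplex ℝ ι)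
    {t : ℝ} (h0 : 0 ≤ t) (h1 : t < 1) {h : ι → ℝ} (hh : 0 ≤ (1 - t • Q) *ᵥ h) : 0 ≤ h := by
  intro k
  obtain ⟨i, -, hi⟩ := Finset.exists_min_image Finset.univ h ⟨k, Finset.mem_univ k⟩
  have e : ((1 - t • Q) *ᵥ h) i = h i - t * ∑ j, Q i j * h j := by
    rw [sub_mulVec, one_mulVec, smul_mulVec]
    rfl
  have h2 : h i ≤ ∑ j, Q i j * h j := by
    have hs : ∑ j, Q i j = 1 := (hQ i).2
    calc h i = ∑ j, Q i j * h i := by rw [← Finset.sum_mul, hs, one_mul]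
      _ ≤ _ := Finset.sum_le_sum fun j hj => mul_le_mul_of_nonneg_left (hi j hj) ((hQ i).1 j)
  have h3 : 0 ≤ h i - t * ∑ j, Q i j * h j := e ▸ hh i
  have h4 := mul_le_mul_of_nonneg_left h2 h0
  have h5 : 0 ≤ h i := by nlinarith
  exact h5.trans (hi k (Finset.mem_univ k))

theorem det_one_sub_smul_ne_zero {Q : Matrix ι ι ℝ} (hQ : ∀ i, Q i ∈ stdSimplex ℝ ι)
    {t : ℝ} (h0 : 0 ≤ t) (h1 : t < 1) : (1 - t • Q).det ≠ 0 := by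
  intro h
  obtain ⟨v, hv, hv0⟩ := exists_mulVec_eq_zero_iff.2 h
  refine hv (le_antisymm ?_ (nonneg_of_one_sub_smul_mulVec_nonneg hQ h0 h1 hv0.ge))
  have := nonneg_of_one_sub_smul_mulVec_nonneg hQ h0 h1 (h := -v) (by rw [mulVec_neg, hv0, neg_zero])
  exact neg_nonneg.1 this

/-- The determinant is `1` at `s = 0` and never vanishes on `[0, t]`. -/
theorem det_one_sub_smul_pos {Q : Matrix ι ι ℝ} (hQ : ∀ i, Q i ∈ stdSimplex ℝ ι)
    {t : ℝ} (h0 : 0 ≤ t) (h1 : t < 1) : 0 < (1 - t • Q).det := by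
  by_contra! h
  have hc : Continuous fun s : ℝ => (1 - s • Q).det := by fun_prop
  obtain ⟨s, hs, hs0⟩ := intermediate_value_Icc' h0 hc.continuousOn
    (show (0 : ℝ) ∈ _ from ⟨h, by simp⟩)
  exact det_one_sub_smul_ne_zero hQ hs.1 (hs.2.trans_lt h1) hs0

theorem cramer_one_sub_smul_nonneg {Q : Matrix ι ι ℝ} (hQ : ∀ i, Q i ∈ stdSimplex ℝ ι)
    {t : ℝ} (h0 : 0 ≤ t) (h1 : t < 1) {d : ι → ℝ} (hd : 0 ≤ d) : 0 ≤ cramer (1 - t • Q) d := by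
  refine nonneg_of_one_sub_smul_mulVec_nonneg hQ h0 h1 ?_
  rw [mulVec_cramer]
  exact smul_nonneg (det_one_sub_smul_pos hQ h0 h1).le hd

/-- Cramer's map is linear and sends `M *ᵥ f` to `M.det • f`. -/
theorem det_updateCol_sub_mul_det (M : Matrix ι ι ℝ) (c f : ι → ℝ) (k : ι) :
    (M.updateCol k c).det - f k * M.det = (M.updateCol k (c - M *ᵥ f)).det := by
  have e : cramer M (M *ᵥ f) = M.det • f := by
    rw [cramer_eq_adjugate_mulVec, mulVec_mulVec, adjugate_mul, smul_mulVec, one_mulVec]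
  rw [← cramer_apply, ← cramer_apply, map_sub, e, Pi.sub_apply, Pi.smul_apply, smul_eq_mul,
    mul_comm]

/-- Multilinearity in the rows: averaging a determinant over independently chosen rows amounts to
averaging each row. -/
theorem sum_prod_mul_det {A : ι → Type*} [∀ ℓ, Fintype (A ℓ)] (p : ∀ ℓ, A ℓ → ℝ)
    (r : ∀ ℓ, A ℓ → ι → ℝ) :
    ∑ a : ∀ ℓ, A ℓ, (∏ ℓ, p ℓ (a ℓ)) * (Matrix.of fun ℓ => r ℓ (a ℓ)).det =
      (Matrix.of fun ℓ => ∑ a, p ℓ a • r ℓ a).det := by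
  have h := (detRowAlternating (n := ι) (R := ℝ)).toMultilinearMap.map_sum
    (fun ℓ a => p ℓ a • r ℓ a)
  refine Eq.trans (Finset.sum_congr rfl fun a _ => ?_) h.symm
  exact ((detRowAlternating (n := ι) (R := ℝ)).toMultilinearMap.map_smul_univ _ _).symm

theorem sum_prod_stdSimplex {A : ι → Type*} [∀ ℓ, Fintype (A ℓ)] (p : ∀ ℓ, stdSimplex ℝ (A ℓ)) :
    ∑ a : ∀ ℓ, A ℓ, ∏ ℓ, (p ℓ).1 (a ℓ) = 1 := by
  rw [← Fintype.piFinset_univ, ← Finset.prod_univ_sum]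
  exact Finset.prod_eq_one fun ℓ _ => (p ℓ).2.2

end Stochastic

/-! ### Reduction to a matrix game over pure stationary strategies -/

namespace StochasticGame

open Matrix

variable {n : ℕ} {I : Fin n → Type*} {J : Fin n → Type*}

/-- The transition matrix when the triple `ζ ℓ` is played at state `ℓ`. -/
def transition (G : StochasticGame I J) (ζ : Fin n → Triple I J) : Matrix (Fin n) (Fin n) ℝ :=
  Matrix.of fun ℓ => (G.q (ζ ℓ)).1

/-- The denominator of Cramer's formula for the discounted payoff. -/
noncomputable def denDet (G : StochasticGame I J) (lam : ℝ) (ζ : Fin n → Triple I J) : ℝ :=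
  (1 - (1 - lam) • G.transition ζ).det

/-- The numerator of Cramer's formula for the discounted payoff. -/
noncomputable def numDet (G : StochasticGame I J) (lam : ℝ) (k : Fin n)
    (ζ : Fin n → Triple I J) : ℝ :=
  ((1 - (1 - lam) • G.transition ζ).updateCol k fun ℓ => lam * G.g (ζ ℓ)).det

theorem denDet_pos (G : StochasticGame I J) {lam : ℝ} (h0 : 0 < lam) (h1 : lam ≤ 1)
    (ζ : Fin n → Triple I J) : 0 < G.denDet lam ζ :=
  det_one_sub_smul_pos (fun ℓ => (G.q (ζ ℓ)).2) (by linarith) (by linarith)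

theorem numDet_sub (G : StochasticGame I J) (lam : ℝ) (f : Fin n → ℝ) (k : Fin n)
    (ζ : Fin n → Triple I J) (hζ : ∀ ℓ, (ζ ℓ).state = ℓ) :
    G.numDet lam k ζ - f k * G.denDet lam ζ =
      ((1 - (1 - lam) • G.transition ζ).updateCol k fun ℓ => G.defect lam f (ζ ℓ)).det := by
  unfold numDet denDet
  rw [det_updateCol_sub_mul_det]
  congr 2
  funext ℓ
  rw [Pi.sub_apply, sub_mulVec, one_mulVec, smul_mulVec]
  simp only [defect, hζ, Pi.sub_apply, Pi.smul_apply, smul_eq_mul, mulVec, dotProduct, transition,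
    Matrix.of_apply]
  ring

/-- Row `ℓ` depends only on the action chosen at state `ℓ`, so product mixing passes inside the
determinant. What remains is a Cramer numerator for an averaged transition matrix, whose sign
follows from the averaged defects. -/
theorem sum_prod_mul_numDet_sub (G : StochasticGame I J) (lam : ℝ) (f : Fin n → ℝ) (k : Fin n)
    {A : Fin n → Type*} [∀ ℓ, Fintype (A ℓ)] (p : ∀ ℓ, stdSimplex ℝ (A ℓ))
    (z : ∀ ℓ, A ℓ → Triple I J) (hz : ∀ ℓ a, (z ℓ a).state = ℓ) :
    ∃ Q : Matrix (Fin n) (Fin n) ℝ, (∀ ℓ, Q ℓ ∈ stdSimplex ℝ (Fin n)) ∧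
      ∑ a : ∀ ℓ, A ℓ, (∏ ℓ, (p ℓ).1 (a ℓ)) *
        (G.numDet lam k (fun ℓ => z ℓ (a ℓ)) - f k * G.denDet lam fun ℓ => z ℓ (a ℓ)) =
      cramer (1 - (1 - lam) • Q) (fun ℓ => ∑ a, (p ℓ).1 a * G.defect lam f (z ℓ a)) k := by
  refine ⟨Matrix.of fun ℓ => ∑ a, (p ℓ).1 a • (G.q (z ℓ a)).1, fun ℓ => ?_, ?_⟩
  · exact (convex_stdSimplex ℝ (Fin n)).sum_mem (fun a _ => (p ℓ).2.1 a) (p ℓ).2.2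
      fun a _ => (G.q (z ℓ a)).2
  · have h := sum_prod_mul_det (fun ℓ => (p ℓ).1) fun ℓ a =>
      Function.update ((1 : Matrix (Fin n) (Fin n) ℝ) ℓ - (1 - lam) • (G.q (z ℓ a)).1) k
        (G.defect lam f (z ℓ a))
    rw [cramer_apply]
    refine Eq.trans (Finset.sum_congr rfl fun a _ => ?_) (h.trans (congrArg det ?_))
    · rw [numDet_sub _ _ _ _ _ fun ℓ => hz ℓ (a ℓ)]
      congr 2
    · ext ℓ ℓ'
      have hp : ∑ a, (p ℓ).1 a = 1 := (p ℓ).2.2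
      simp only [Matrix.of_apply, Finset.sum_apply, Pi.smul_apply, updateCol_apply,
        Function.update_apply, smul_eq_mul]
      split_ifs
      · rfl
      · simp only [Pi.sub_apply, Pi.smul_apply, smul_eq_mul, Matrix.sub_apply, Matrix.smul_apply,
          Matrix.of_apply, Finset.sum_apply, mul_sub, Finset.sum_sub_distrib, ← Finset.sum_mul, hp,
          one_mul, Finset.mul_sum]
        congr 1
        exact Finset.sum_congr rfl fun a _ => by ring

variable [∀ ℓ, Fintype (I ℓ)] [∀ ℓ, Fintype (J ℓ)]

/-- Optimal stationary strategies, read as product distributions on pure stationary strategies,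
certify that the matrix game with entries `numDet - f k * denDet` has value zero. -/
theorem ShapleySolution.exists_singular_kernel [DecidableEq (∀ ℓ, I ℓ)] {G : StochasticGame I J}
    {lam : ℝ} {f : Fin n → ℝ} {x : ∀ ℓ, stdSimplex ℝ (I ℓ)} {y : ∀ ℓ, stdSimplex ℝ (J ℓ)}
    [∀ ℓ, Nonempty (J ℓ)]
    (hf : G.ShapleySolution lam f x y) (h0 : 0 < lam) (h1 : lam ≤ 1) (k : Fin n) :
    ∃ (S : Finset (∀ ℓ, I ℓ)) (c : S → ∀ ℓ, J ℓ),
      (Matrix.of fun s t : S => G.numDet lam k (fun ℓ => ⟨ℓ, s.1 ℓ, c t ℓ⟩) -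
        f k * G.denDet lam fun ℓ => ⟨ℓ, s.1 ℓ, c t ℓ⟩).det = 0 ∧
      ∃ z, (Matrix.of fun s t : S => G.numDet lam k (fun ℓ => ⟨ℓ, s.1 ℓ, c t ℓ⟩) -
        z * G.denDet lam fun ℓ => ⟨ℓ, s.1 ℓ, c t ℓ⟩).det ≠ 0 := by
  refine _root_.exists_singular_kernel
    (fun (i : ∀ ℓ, I ℓ) (j : ∀ ℓ, J ℓ) => G.numDet lam k fun ℓ => ⟨ℓ, i ℓ, j ℓ⟩)
    (fun i j => G.denDet lam fun ℓ => ⟨ℓ, i ℓ, j ℓ⟩) (fun i j => G.denDet_pos h0 h1 _) (f k)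
    (x := fun i => ∏ ℓ, (x ℓ).1 (i ℓ)) (y := fun j => ∏ ℓ, (y ℓ).1 (j ℓ))
    (fun i => Finset.prod_nonneg fun ℓ _ => (x ℓ).2.1 _) (fun h => ?_) (fun j => ?_)
    (fun i => Finset.prod_nonneg fun ℓ _ => (y ℓ).2.1 _) (sum_prod_stdSimplex y) (fun i => ?_)
  · have := sum_prod_stdSimplex x
    simp only [funext_iff, Pi.zero_apply] at h
    simp [h] at this
  · obtain ⟨Q, hQ, e⟩ := G.sum_prod_mul_numDet_sub lam f k x (fun ℓ i => ⟨ℓ, i, j ℓ⟩)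
      fun _ _ => rfl
    rw [e]
    exact cramer_one_sub_smul_nonneg hQ (by linarith) (by linarith) (fun ℓ => hf.left ℓ (j ℓ)) k
  · obtain ⟨Q, hQ, e⟩ := G.sum_prod_mul_numDet_sub lam f k y (fun ℓ j => ⟨ℓ, i ℓ, j⟩)
      fun _ _ => rfl
    rw [e]
    have := cramer_one_sub_smul_nonneg hQ (t := 1 - lam) (by linarith) (by linarith)
      (fun ℓ => neg_nonneg.2 (hf.right ℓ (i ℓ))) k
    have e2 : (fun ℓ => -∑ j, (y ℓ).1 j * G.defect lam f ⟨ℓ, i ℓ, j⟩) =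
      -fun ℓ => ∑ j, (y ℓ).1 j * G.defect lam f ⟨ℓ, i ℓ, j⟩ := rfl
    rw [e2, map_neg] at this
    exact neg_nonneg.1 this

end StochasticGame

/-! ### Integer polynomial form of the matrix game -/

namespace StochasticGame

open Matrix MvPolynomial

variable {n : ℕ} {I : Fin n → Type*} {J : Fin n → Type*}

/-- Integer data `(gN, qN)` such that the payoffs and the transition probabilities of `G` are
`gN / N` and `qN / N`. -/
structure HasNumerators (G : StochasticGame I J) (N : ℕ) (gN : Triple I J → ℕ)
    (qN : Triple I J → Fin n → ℕ) : Prop where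
  pos : 0 < N
  g_le : ∀ z, gN z ≤ N
  g_eq : ∀ z, (N : ℝ) * G.g z = gN z
  q_eq : ∀ z ℓ, (N : ℝ) * (G.q z).1 ℓ = qN z ℓ

theorem RationalData.exists_hasNumerators {G : StochasticGame I J} {N : ℕ} (hN : 1 ≤ N)
    (hG : G.RationalData N) : ∃ gN qN, G.HasNumerators N gN qN := by
  choose gN hg hg' using hG.1
  choose qN hq hq' using hG.2
  have hN0 : (N : ℝ) ≠ 0 := by positivity
  exact ⟨gN, qN, hN, hg, fun z => by rw [hg']; field_simp, fun z ℓ => by rw [hq']; field_simp⟩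

theorem RationalData.g_mem_Icc {G : StochasticGame I J} {N : ℕ} (hG : G.RationalData N)
    (z : Triple I J) : G.g z ∈ Set.Icc (0 : ℝ) 1 := by
  obtain ⟨m, hm, h⟩ := hG.1 z
  rw [h]
  exact ⟨by positivity, div_le_one_of_le₀ (by exact_mod_cast hm) (by positivity)⟩

theorem HasNumerators.sum_q {G : StochasticGame I J} {N : ℕ} {gN : Triple I J → ℕ}
    {qN : Triple I J → Fin n → ℕ} (h : G.HasNumerators N gN qN) (z : Triple I J) :
    ∑ ℓ, qN z ℓ = N := by
  have h1 : ∑ ℓ, (G.q z).1 ℓ = 1 := (G.q z).2.2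
  have : ((∑ ℓ, qN z ℓ : ℕ) : ℝ) = N := by
    push_cast
    simp_rw [← h.q_eq, ← Finset.mul_sum, h1, mul_one]
  exact_mod_cast this

variable (N : ℕ) (gN : Triple I J → ℕ) (qN : Triple I J → Fin n → ℕ)

/-- The matrix `N (1 - (1 - λ) Q)`, where `λ` is the variable `X 1`. -/
noncomputable def transPoly (ζ : Fin n → Triple I J) :
    Matrix (Fin n) (Fin n) (MvPolynomial (Fin 2) ℤ) :=
  Matrix.of fun ℓ ℓ' => C (if ℓ = ℓ' then (N : ℤ) else 0) - (1 - X 1) * C (qN (ζ ℓ) ℓ' : ℤ)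

/-- The column `N λ g`, where `λ` is the variable `X 1`. -/
noncomputable def payoffPoly (ζ : Fin n → Triple I J) (ℓ : Fin n) : MvPolynomial (Fin 2) ℤ :=
  X 1 * C (gN (ζ ℓ) : ℤ)

/-- The polynomial `N ^ n (b * numDet - (a + w) * denDet)`, where `w` is the variable `X 0`. -/
noncomputable def entryPoly (k : Fin n) (a b : ℕ) (ζ : Fin n → Triple I J) :
    MvPolynomial (Fin 2) ℤ :=
  C (b : ℤ) * ((transPoly N qN ζ).updateCol k (payoffPoly gN ζ)).det -
    (C (a : ℤ) + X 0) * (transPoly N qN ζ).det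

variable {N gN qN}

theorem HasNumerators.aeval_entryPoly {G : StochasticGame I J} (h : G.HasNumerators N gN qN)
    (k : Fin n) (a b : ℕ) (ζ : Fin n → Triple I J) (w lam : ℝ) :
    aeval ![w, lam] (entryPoly N gN qN k a b ζ) =
      (N : ℝ) ^ n * (b * G.numDet lam k ζ - (a + w) * G.denDet lam ζ) := by
  have e1 : (aeval ![w, lam]).mapMatrix (transPoly N qN ζ) =
      (N : ℝ) • (1 - (1 - lam) • G.transition ζ) := by
    ext ℓ ℓ'
    by_cases hl : ℓ = ℓ' <;>
      simp [transPoly, transition, ← h.q_eq, hl] <;> ring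
  have e2 : (aeval ![w, lam]).mapMatrix ((transPoly N qN ζ).updateCol k (payoffPoly gN ζ)) =
      (N : ℝ) • ((1 - (1 - lam) • G.transition ζ).updateCol k fun ℓ => lam * G.g (ζ ℓ)) := by
    ext ℓ ℓ'
    have := congrFun (congrFun e1 ℓ) ℓ'
    simp only [AlgHom.mapMatrix_apply, Matrix.map_apply, Matrix.smul_apply] at this
    simp only [AlgHom.mapMatrix_apply, Matrix.map_apply, Matrix.smul_apply, updateCol_apply]
    split_ifs
    · simp [payoffPoly, ← h.g_eq]
      ring
    · exact this
  unfold entryPoly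
  rw [map_sub, map_mul, map_mul, AlgHom.map_det, AlgHom.map_det, e1, e2, det_smul, det_smul]
  simp only [numDet, denDet, Fintype.card_fin, map_add, aeval_X, Matrix.cons_val_zero]
  simp
  ring

theorem HasNumerators.l1_entryPoly_le {G : StochasticGame I J} (h : G.HasNumerators N gN qN)
    (k : Fin n) {a b : ℕ} (hab : a < b) (ζ : Fin n → Triple I J) :
    (entryPoly N gN qN k a b ζ).l1 ≤ 2 * b * (4 * N) ^ n := by
  have h1 : ((1 : MvPolynomial (Fin 2) ℤ) - X 1).l1 ≤ 2 :=
    (l1_sub_le _ _).trans (Nat.add_le_add (l1_C_le 1) (l1_X_le 1))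
  -- The diagonal contributes `N`; the factor `1 - X 1` has coefficient sum at most `2` and the
  -- numerators sum to `N`. The payoff column adds at most another `N` in `hrow'`.
  have hrow : ∀ ℓ, ∑ ℓ', (transPoly N qN ζ ℓ ℓ').l1 ≤ 3 * N := by
    intro ℓ
    calc _ ≤ ∑ ℓ', ((if ℓ = ℓ' then N else 0) + 2 * qN (ζ ℓ) ℓ') := by
          refine Finset.sum_le_sum fun ℓ' _ => (l1_sub_le _ _).trans (Nat.add_le_add
            ((l1_C_le _).trans ?_) ((l1_mul_le _ _).trans (Nat.mul_le_mul h1 (l1_C_le _))))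
          split_ifs <;> simp
      _ = 3 * N := by
          rw [Finset.sum_add_distrib, ← Finset.mul_sum, h.sum_q]
          simp
          ring
  have hrow' : ∀ ℓ, ∑ ℓ', ((transPoly N qN ζ).updateCol k (payoffPoly gN ζ) ℓ ℓ').l1 ≤ 4 * N := by
    intro ℓ
    calc _ ≤ ∑ ℓ', ((transPoly N qN ζ ℓ ℓ').l1 + if ℓ' = k then N else 0) := by
          refine Finset.sum_le_sum fun ℓ' _ => ?_
          rw [updateCol_apply]
          split_ifs
          · refine le_trans ?_ (Nat.le_add_left _ _)
            exact (l1_mul_le _ _).trans ((Nat.mul_le_mul (l1_X_le 1) (l1_C_le _)).trans (by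
              simpa using h.g_le _))
          · simp
      _ ≤ 4 * N := by
          rw [Finset.sum_add_distrib]
          simp only [Finset.sum_ite_eq', Finset.mem_univ, if_true]
          linarith [hrow ℓ]
  have hden : ((transPoly N qN ζ).det).l1 ≤ (4 * N) ^ n :=
    (l1_det_le _).trans ((Finset.prod_le_prod' fun ℓ _ => (hrow ℓ).trans
      (Nat.mul_le_mul_right N (by norm_num : 3 ≤ 4))).trans_eq (by simp))
  have hnum : (((transPoly N qN ζ).updateCol k (payoffPoly gN ζ)).det).l1 ≤ (4 * N) ^ n :=
    (l1_det_le _).trans ((Finset.prod_le_prod' fun ℓ _ => hrow' ℓ).trans_eq (by simp))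
  -- Strict inequality `a < b` absorbs the extra coefficient of `X 0`.
  have ha : (C (a : ℤ) + X 0 : MvPolynomial (Fin 2) ℤ).l1 ≤ b :=
    (l1_add_le _ _).trans ((Nat.add_le_add (l1_C_le _) (l1_X_le 0)).trans (by simpa using hab))
  calc _ ≤ b * (4 * N) ^ n + b * (4 * N) ^ n :=
        (l1_sub_le _ _).trans (Nat.add_le_add
          ((l1_mul_le _ _).trans (Nat.mul_le_mul ((l1_C_le _).trans (by simp)) hnum))
          ((l1_mul_le _ _).trans (Nat.mul_le_mul ha hden)))
    _ = 2 * b * (4 * N) ^ n := by ring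

end StochasticGame

/-! ### Numerical bound on the coefficient sums -/

theorem add_one_le_two_pow_bitSize (N : ℕ) : N + 1 ≤ 2 ^ bitSize N := by
  have h : Real.logb 2 ((N : ℝ) + 1) ≤ bitSize N := Nat.le_ceil _
  rw [Real.logb_le_iff_le_rpow (by norm_num) (by positivity), Real.rpow_natCast] at h
  exact_mod_cast h

theorem height_lt_two_pow {d n N B r : ℕ} (hd : 1 ≤ d) (hn : 1 ≤ n) (hN : 1 ≤ N)
    (hB : N + 1 ≤ 2 ^ B) (hr : 1 ≤ r) :
    (d * (2 * 2 ^ r * (4 * N) ^ n)) ^ d < 2 ^ (10 * d ^ 2 * n ^ 2 * B * r) := by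
  have hB1 : 1 ≤ B := by
    by_contra! h
    interval_cases B
    omega
  have h1 : (4 * N) ^ n ≤ 2 ^ ((2 + B) * n) := by
    rw [pow_mul, pow_add]
    exact Nat.pow_le_pow_left (Nat.mul_le_mul_left 4 (by omega)) n
  have h2 : d * (2 * 2 ^ r * (4 * N) ^ n) < 2 ^ (d + (1 + r + (2 + B) * n)) := by
    rw [pow_add _ d]
    refine Nat.mul_lt_mul_of_lt_of_le Nat.lt_two_pow_self ?_ (by positivity)
    rw [pow_add _ (1 + r), pow_add, pow_one]
    exact Nat.mul_le_mul_left _ h1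
  refine (Nat.pow_lt_pow_left h2 (by omega)).trans_le ?_
  rw [← pow_mul]
  refine Nat.pow_le_pow_right (by norm_num) ?_
  -- Each of `d`, `1`, `r`, `n` and `B * n` is at most `P`, so the exponent `d + 1 + r + 2 * n + B *
  -- n` is at most `6 * P`, within the allowed `10 * P`.
  set P := d * n ^ 2 * B * r with hP
  have hP0 : 0 < P := by positivity
  have p1 : d ≤ P := Nat.le_of_dvd hP0 ⟨n ^ 2 * B * r, by ring⟩
  have p2 : r ≤ P := Nat.le_of_dvd hP0 ⟨d * n ^ 2 * B, by ring⟩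
  have p3 : n ≤ P := Nat.le_of_dvd hP0 ⟨d * n * B * r, by ring⟩
  have p4 : B * n ≤ P := Nat.le_of_dvd hP0 ⟨d * n * r, by ring⟩
  calc (d + (1 + r + (2 + B) * n)) * d ≤ 10 * P * d :=
        Nat.mul_le_mul_right d (by linarith)
    _ = _ := by rw [hP]; ring

/-! ### The dyadic crossing argument -/

namespace StochasticGame

open Matrix MvPolynomial

variable {n : ℕ} {I : Fin n → Type*} {J : Fin n → Type*}
variable [∀ ℓ, Fintype (I ℓ)] [∀ ℓ, Fintype (J ℓ)] [∀ ℓ, Nonempty (I ℓ)] [∀ ℓ, Nonempty (J ℓ)]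

theorem isValue_lowerValue (G : StochasticGame I J) (hg : ∀ z, G.g z ∈ Set.Icc (0 : ℝ) 1)
    (k : Fin n) {lam : ℝ} (h0 : 0 < lam) (h1 : lam ≤ 1) :
    G.IsValue lam k (G.lowerValue lam k) := by
  obtain ⟨f, x, y, hf⟩ := G.exists_shapleySolution h0 h1
  have h := hf.isValue h0 h1 hg k
  exact h.1 ▸ h

theorem lowerValue_mem_Icc (G : StochasticGame I J) (hg : ∀ z, G.g z ∈ Set.Icc (0 : ℝ) 1)
    (k : Fin n) {lam : ℝ} (h0 : 0 < lam) (h1 : lam ≤ 1) :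
    G.lowerValue lam k ∈ Set.Icc (0 : ℝ) 1 := by
  obtain ⟨f, x, y, hf⟩ := G.exists_shapleySolution h0 h1
  exact (hf.isValue h0 h1 hg k).1 ▸ hf.mem_Icc h0 h1 hg k

/-- The value does not cross a dyadic number `a / 2 ^ r` for small discount factors. -/
theorem abs_lowerValue_sub_le (G : StochasticGame I J) {N : ℕ} (hN : 1 ≤ N)
    (hG : G.RationalData N) (k : Fin n) {r : ℕ} (hr : 1 ≤ r) {lam₁ lam₂ : ℝ} (h₁ : 0 < lam₁)
    (h₂ : 0 < lam₂)
    (h₁' : lam₁ ≤ 1 / 2 ^ (10 * Fintype.card (∀ ℓ, I ℓ) ^ 2 * n ^ 2 * bitSize N * r))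
    (h₂' : lam₂ ≤ 1 / 2 ^ (10 * Fintype.card (∀ ℓ, I ℓ) ^ 2 * n ^ 2 * bitSize N * r)) :
    |G.lowerValue lam₁ k - G.lowerValue lam₂ k| ≤ 1 / 2 ^ r := by
  classical
  set d := Fintype.card (∀ ℓ, I ℓ) with hd
  set K := 10 * d ^ 2 * n ^ 2 * bitSize N * r with hK
  have hK1 : (1 : ℝ) / 2 ^ K ≤ 1 := by
    rw [div_le_one (by positivity)]
    exact one_le_pow₀ one_le_two
  have hg := hG.g_mem_Icc
  obtain ⟨gN, qN, hnum⟩ := hG.exists_hasNumerators hN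
  set V := fun lam => G.lowerValue lam k with hV
  by_contra! hgap
  set lo := V lam₁ ⊓ V lam₂ with hlo
  set hi := V lam₁ ⊔ V lam₂ with hhi
  have hgap' : 1 / 2 ^ r < hi - lo := by
    rw [hlo, hhi, max_sub_min_eq_abs']
    exact hgap
  have m₁ := G.lowerValue_mem_Icc hg k h₁ (h₁'.trans hK1)
  have m₂ := G.lowerValue_mem_Icc hg k h₂ (h₂'.trans hK1)
  have hlo0 : 0 ≤ lo := le_min m₁.1 m₂.1
  have hhi1 : hi ≤ 1 := max_le m₁.2 m₂.2
  set b : ℕ := 2 ^ r with hb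
  have hb0 : (0 : ℝ) < b := by positivity
  have hgapb : 1 < (hi - lo) * b := by
    rw [div_lt_iff₀ (by positivity)] at hgap'
    exact_mod_cast hgap'
  -- The first integer strictly above `lo * b`; it stays below `hi * b` because the scaled gap
  -- exceeds `1`.
  set a : ℕ := ⌊lo * b⌋₊ + 1 with ha
  have ha1 : lo * b < a := by
    rw [ha]
    push_cast
    exact Nat.lt_floor_add_one _
  have ha2 : (a : ℝ) < hi * b := by
    have := Nat.floor_le (mul_nonneg hlo0 hb0.le)
    rw [ha]
    push_cast
    linarith
  have hab : a < b := by
    have : (a : ℝ) < b := ha2.trans_le (mul_le_of_le_one_left hb0.le hhi1)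
    exact_mod_cast this
  let T : (Σ S : Finset (∀ ℓ, I ℓ), (S → ∀ ℓ, J ℓ)) → MvPolynomial (Fin 2) ℤ := fun p =>
    (Matrix.of fun s t : p.1 =>
      entryPoly N gN qN k a b fun ℓ => (⟨ℓ, s.1 ℓ, p.2 t ℓ⟩ : Triple I J)).det
  -- The degree bound must be uniform over all kernels: `w` is fixed before `lam` and its kernel are
  -- known, so it is compared with the `D`-th power of the smaller discount factor.
  obtain ⟨D, hD⟩ := (Set.finite_range fun p => (T p).degreeOf 1).bddAbove
  have hD' : ∀ p, (T p).degreeOf 1 ≤ D := fun p => hD ⟨p, rfl⟩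
  have hd1 : 1 ≤ d := Fintype.card_pos
  have hn1 : 1 ≤ n := k.pos
  set H := (d * (2 * 2 ^ r * (4 * N) ^ n)) ^ d with hH
  have hHK : H < 2 ^ K := height_lt_two_pow hd1 hn1 hN (add_one_le_two_pow_bitSize N) hr
  have hH0 : 0 < H := by positivity
  have hTl1 : ∀ p, (T p).l1 ≤ H := by
    intro p
    have hcard : Fintype.card p.1 ≤ d := by
      rw [Fintype.card_coe]
      exact Finset.card_le_univ _
    calc (T p).l1 ≤ ∏ _s : p.1, ∑ _t : p.1, 2 * b * (4 * N) ^ n :=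
          (l1_det_le _).trans (Finset.prod_le_prod' fun s _ => Finset.sum_le_sum fun t _ =>
            hnum.l1_entryPoly_le k hab _)
      _ = (Fintype.card p.1 * (2 * 2 ^ r * (4 * N) ^ n)) ^ Fintype.card p.1 := by
          simp only [Finset.sum_const, Finset.prod_const, Finset.card_univ, smul_eq_mul, hb]
      _ ≤ (d * (2 * 2 ^ r * (4 * N) ^ n)) ^ Fintype.card p.1 :=
          Nat.pow_le_pow_left (Nat.mul_le_mul_right _ hcard) _
      _ ≤ H := Nat.pow_le_pow_right (by positivity) hcard
  have hTeval : ∀ p w lam, aeval ![w, lam] (T p) = ((N : ℝ) ^ n * b) ^ Fintype.card p.1 *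
      (Matrix.of fun s t : p.1 => G.numDet lam k (fun ℓ => ⟨ℓ, s.1 ℓ, p.2 t ℓ⟩) -
        (a + w) / b * G.denDet lam fun ℓ => ⟨ℓ, s.1 ℓ, p.2 t ℓ⟩).det := by
    intro p w lam
    rw [AlgHom.map_det, ← det_smul]
    congr 1
    ext s t
    simp only [AlgHom.mapMatrix_apply, Matrix.map_apply, Matrix.of_apply, Matrix.smul_apply,
      hnum.aeval_entryPoly, smul_eq_mul]
    field_simp
  have hμ : 0 < lam₁ ⊓ lam₂ := lt_min h₁ h₂
  obtain ⟨w, hw0, hw⟩ := exists_between (lt_min one_pos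
    (lt_min (sub_pos.2 ha2) (div_pos (pow_pos hμ D) (Nat.cast_pos.2 hH0))))
  have hw1 : w < 1 := hw.trans_le (min_le_left _ _)
  have hw2 : w < hi * b - a := hw.trans_le ((min_le_right _ _).trans (min_le_left _ _))
  have hw3 : H * w < (lam₁ ⊓ lam₂) ^ D := by
    have := hw.trans_le ((min_le_right _ _).trans (min_le_right _ _))
    rwa [lt_div_iff₀ (Nat.cast_pos.2 hH0), mul_comm] at this
  have hcont : ContinuousOn V (Set.uIcc lam₁ lam₂) :=
    (G.continuousOn_lowerValue hg k).mono fun l hl =>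
      ⟨hμ.trans_le hl.1, hl.2.trans (max_le (h₁'.trans hK1) (h₂'.trans hK1))⟩
  obtain ⟨lam, hlam, hVlam⟩ := intermediate_value_uIcc hcont
    (show (a + w) / b ∈ Set.uIcc (V lam₁) (V lam₂) from
      ⟨by rw [le_div_iff₀ hb0]; linarith, by rw [div_le_iff₀ hb0]; linarith⟩)
  have hlam0 : 0 < lam := hμ.trans_le hlam.1
  have hlamK : lam ≤ 1 / 2 ^ K := hlam.2.trans (max_le h₁' h₂')
  have hlam1 : lam ≤ 1 := hlamK.trans hK1
  obtain ⟨f, x, y, hf⟩ := G.exists_shapleySolution hlam0 hlam1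
  obtain ⟨S, c, hdet, z, hz⟩ := hf.exists_singular_kernel hlam0 hlam1 k
  have hfk : f k = (a + w) / b := (hf.isValue hlam0 hlam1 hg k).1.trans hVlam
  refine aeval_ne_zero_of_small (p := T ⟨S, c⟩) ?_ (hTl1 _) (hD' _) hw0 hw1.le hlam0 hlam1 ?_
    (hw3.trans_le (pow_le_pow_left₀ hμ.le hlam.1 D)) ?_
  · intro h0
    -- This choice of `w` makes `(a + w) / b` equal to `z`, where the kernel is nonsingular; hence
    -- the polynomial is nonzero.
    have := hTeval ⟨S, c⟩ (z * b - a) lam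
    rw [h0, map_zero, add_sub_cancel, mul_div_cancel_right₀ _ hb0.ne'] at this
    have hN0 : (0 : ℝ) < N := by exact_mod_cast hN
    exact mul_ne_zero (by positivity) hz this.symm
  · have hHK' : (H : ℝ) < 2 ^ K := by exact_mod_cast hHK
    calc (H : ℝ) * lam < 2 ^ K * lam := mul_lt_mul_of_pos_right hHK' hlam0
      _ ≤ 2 ^ K * (1 / 2 ^ K) := mul_le_mul_of_nonneg_left hlamK (by positivity)
      _ = 1 := by field_simp
  · rw [hTeval, ← hfk]
    exact mul_eq_zero_of_right _ hdet

end StochasticGame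

/-! ### From the Cauchy modulus to the limit and its rate -/

theorem exists_limit_of_dyadic_modulus {V : ℝ → ℝ} {K : ℕ}
    (h : ∀ r l₁ l₂, 0 < l₁ → 0 < l₂ → l₁ ≤ 1 / 2 ^ (K * r) → l₂ ≤ 1 / 2 ^ (K * r) →
      |V l₁ - V l₂| ≤ 1 / 2 ^ r) :
    ∃ w, Tendsto V (𝓝[>] 0) (𝓝 w) ∧
      ∀ r : ℕ, ∀ l, 0 < l → l ≤ 1 / 2 ^ (K * r) → |V l - w| ≤ 1 / 2 ^ r := by
  have hmono : ∀ {r s : ℕ}, r ≤ s → (1 : ℝ) / 2 ^ (K * s) ≤ 1 / 2 ^ (K * r) := fun hrs =>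
    one_div_pow_le_one_div_pow_of_le one_le_two (Nat.mul_le_mul_left K hrs)
  have hlim : Tendsto (fun r : ℕ => (1 : ℝ) / 2 ^ r) atTop (𝓝 0) := by
    simpa [one_div] using tendsto_pow_atTop_nhds_zero_of_lt_one (r := (2⁻¹ : ℝ)) (by norm_num)
      (by norm_num)
  have hc : CauchySeq fun s : ℕ => V (1 / 2 ^ (K * s)) :=
    cauchySeq_of_le_tendsto_0 _ (fun s t r hs ht =>
      h r _ _ (by positivity) (by positivity) (hmono hs) (hmono ht)) hlim
  obtain ⟨w, hw⟩ := cauchySeq_tendsto_of_complete hc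
  have hb : ∀ r : ℕ, ∀ l, 0 < l → l ≤ 1 / 2 ^ (K * r) → |V l - w| ≤ 1 / 2 ^ r := by
    intro r l hl hl'
    -- Compare `V l` with the values along `1 / 2 ^ (K * s)` and let `s` tend to infinity; the bound
    -- passes to the limit without loss.
    refine le_of_tendsto ((tendsto_const_nhds.sub hw).abs) ?_
    filter_upwards [eventually_ge_atTop r] with s hs
    exact h r _ _ hl (by positivity) hl' (hmono hs)
  refine ⟨w, ?_, hb⟩
  rw [Metric.tendsto_nhds]
  intro ε hε
  obtain ⟨r, hr⟩ := (hlim.eventually (gt_mem_nhds hε)).exists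
  filter_upwards [Ioc_mem_nhdsGT (show (0 : ℝ) < 1 / 2 ^ (K * r) by positivity)] with l hl
  exact (hb r l hl.1 hl.2).trans_lt hr

theorem mainTheorem3 {n : ℕ} (I : Fin n → Type*) (J : Fin n → Type*)
    [∀ ℓ, Fintype (I ℓ)] [∀ ℓ, Fintype (J ℓ)] [∀ ℓ, Nonempty (I ℓ)] [∀ ℓ, Nonempty (J ℓ)]
    (G : StochasticGame I J) (N : ℕ) (hN : 1 ≤ N) (hG : G.RationalData N) (k : Fin n) :
    ∃ (v : ℝ → ℝ) (w : ℝ),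
      (∀ lam ∈ Set.Ioc (0 : ℝ) 1, G.IsValue lam k (v lam)) ∧
      Tendsto v (𝓝[>] 0) (𝓝 w) ∧
      ∀ r : ℕ, ∀ lam : ℝ, 0 < lam →
        lam ≤ 1 / 2 ^ (10 * Fintype.card (∀ ℓ, I ℓ) ^ 2 * n ^ 2 * bitSize N * r) →
        |v lam - w| ≤ 1 / 2 ^ r := by
  have hg := hG.g_mem_Icc
  obtain ⟨w, hw, hb⟩ := exists_limit_of_dyadic_modulus (V := fun lam => G.lowerValue lam k)
    (K := 10 * Fintype.card (∀ ℓ, I ℓ) ^ 2 * n ^ 2 * bitSize N) (by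
      intro r l₁ l₂ h₁ h₂ h₁' h₂'
      -- For `r = 0` the bound is trivial, since both values lie in `[0, 1]`; the height estimate
      -- requires `r ≥ 1`.
      rcases Nat.eq_zero_or_pos r with rfl | hr
      · simp only [mul_zero, pow_zero, div_one] at h₁' h₂' ⊢
        have m₁ := G.lowerValue_mem_Icc hg k h₁ h₁'
        have m₂ := G.lowerValue_mem_Icc hg k h₂ h₂'
        rw [abs_le]
        constructor <;> linarith [m₁.1, m₁.2, m₂.1, m₂.2]
      · exact G.abs_lowerValue_sub_le hN hG k hr h₁ h₂ h₁' h₂')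
  exact ⟨fun lam => G.lowerValue lam k, w,
    fun lam hlam => G.isValue_lowerValue hg k hlam.1 hlam.2, hw, hb⟩
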